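/- Let $(D,\mu)$ be a measure space with $D\neq\emptyset$, and let $H$ be a reproducing kernel Hilbert space of complex-valued functions on $D$ (a complex Hilbert space of functions on which all point evaluations are continuous) with kernel $K$. Assume that $H\subset L_2=L_2(D,\mu)$, where the embedding $H\hookrightarrow L_2$ is continuous and injective, i.e. $$\sup_{0\ne f\in H}\frac{\|f\|_2^2}{\|f\|_H^2}<\infty ,\qquad \|f\|_2\neq 0\ \text{ for all } f\in H\setminus\{0\},$$ and that $K$ has finite trace, $\int_D K(x,x)\,d\mu(x)<\infty$. Let $\sigma_0\ge\sigma_1\ge\dots\ge 0$ be the singular values of the embedding $H\hookrightarrow L_2$, repeated according to multiplicity and continued by $0$ if there are only finitely many. Let $B_H$ be the closed unit ball of $H$, and let $$g_n(B_H,L_2)=\inf_{\substack{x_1,\dots,x_n\in D\\ \varphi_1,\dots,\varphi_n\in L_2}}\ \sup_{f\in B_H}\Big\|f-\sum_{i=1}^n f(x_i)\,\varphi_i\Big\|_2$$ be the linear sampling numbers. Then $\sum_{k}\sigma_k^2<\infty$, and for all integers $m\ge 1$ and $n\ge m$, with $r=\sqrt{\frac{m-1}{n}}$, $$g_n(B_H,L_2)\le\Big(1+\frac1{1-r}\Big)\Big(\sigma_m+\sqrt{\frac1n\sum_{k>m}\sigma_k^2}\Big).$$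 In particular, for all integers $m\ge1$, $$g_{2m}(B_H,L_2)\le 5\Big(\sigma_m+\sqrt{\frac1{2m}\sum_{k>m}\sigma_k^2}\Big)\quad\text{and}\quad g_m(B_H,L_2)\le(2m+1)\Big(\sigma_m+\sqrt{\frac1m\sum_{k>m}\sigma_k^2}\Big).$$ -/

import Mathlib

open MeasureTheory
open scoped ENNReal InnerProductSpace

noncomputable section

/-- `σ_k(T)`, `k = 0, 1, 2, …`: the singular values of a compact operator `T` between Hilbert
spaces, i.e. the square roots of the positive eigenvalues of `T* T`, listed in decreasing order and
repeated according to multiplicity, and continued by `0` if there are only finitely many.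
Accordingly `σ_k(T)` is the largest `s > 0` such that `T* T` has at least `k + 1` eigenvalues
`≥ s ^ 2` counted with multiplicity (that is, `k + 1` orthonormal eigenvectors belonging to
eigenvalues `t ^ 2` with `t ≥ s`), and it is `0 = sSup ∅` if there is no such `s`. -/
def singularValue {E F : Type*}
    [NormedAddCommGroup E] [InnerProductSpace ℂ E] [CompleteSpace E]
    [NormedAddCommGroup F] [InnerProductSpace ℂ F] [CompleteSpace F]
    (T : E →L[ℂ] F) (k : ℕ) : ℝ :=
  sSup {s : ℝ | 0 < s ∧ ∃ v : Fin (k + 1) → E, Orthonormal ℂ v ∧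
    ∀ i, ∃ t : ℝ, s ≤ t ∧
      (ContinuousLinearMap.adjoint T) (T (v i)) = ((t ^ 2 : ℝ) : ℂ) • v i}

/-- The linear sampling number `g_n^lin(F, L_2(D, μ))` of a class `F` of functions on `D`: the
infimum, over sampling points `x_1, …, x_n ∈ D` and functions `φ_1, …, φ_n ∈ L_2(D, μ)`, of the
worst-case error `sup_{f ∈ F} ‖f - ∑ i, f(x_i) φ_i‖_2`, as an extended nonnegative real. -/
def linSamplingNumber {D : Type*} [MeasurableSpace D] (μ : Measure D)
    (F : Set (D → ℂ)) (n : ℕ) : ℝ≥0∞ :=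
  ⨅ (x : Fin n → D) (φ : Fin n → D → ℂ) (_ : ∀ i, MemLp (φ i) 2 μ),
    ⨆ f ∈ F, eLpNorm (fun t => f t - ∑ i, f (x i) * φ i t) 2 μ

section RKHSpace

variable {D : Type*} [MeasurableSpace D]
variable (H : Type*) [NormedAddCommGroup H] [InnerProductSpace ℂ H] [RKHS ℂ H D ℂ]

/-- The unit ball `B_H`, as a set of functions on `D`. -/
def unitBallFunctions : Set (D → ℂ) :=
  (fun f : H => (f : D → ℂ)) '' Metric.closedBall (0 : H) 1

/-- The reproducing kernel Hilbert space `H` of functions on `D` is contained in `L_2(D, μ)`, and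
the embedding is continuous and injective. -/
structure EmbedsInL2 (μ : Measure D) : Prop where
  memLp : ∀ f : H, MemLp (f : D → ℂ) 2 μ
  continuous : ∃ C : ℝ, ∀ f : H, (eLpNorm (f : D → ℂ) 2 μ).toReal ≤ C * ‖f‖
  injective : ∀ f : H, f ≠ 0 → eLpNorm (f : D → ℂ) 2 μ ≠ 0

/-- The trace `∫ K(x, x) dμ(x) ∈ [0, ∞]` of the kernel `K` of `H`. Mathlib's `RKHS.kernel H x y` is
the linear map `c ↦ K(x, y) c` on `ℂ`, and `K(x, x)` is real and nonnegative. -/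
def kernelTrace [CompleteSpace H] (μ : Measure D) : ℝ≥0∞ :=
  ∫⁻ x : D, ENNReal.ofReal (RKHS.kernel H x x 1).re ∂μ

variable {H}

/-- The embedding `H ↪ L_2(D, μ)`, sending a function to its class. -/
def EmbedsInL2.embedding {μ : Measure D} (h : EmbedsInL2 H μ) : H →L[ℂ] Lp ℂ 2 μ :=
  LinearMap.mkContinuousOfExistsBound
    { toFun := fun f => (h.memLp f).toLp f
      map_add' := fun f g => by
        rw [← MemLp.toLp_add (h.memLp f) (h.memLp g)]
        exact MemLp.toLp_congr _ _ (by simp)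
      map_smul' := fun c f => by
        rw [RingHom.id_apply, ← MemLp.toLp_const_smul c (h.memLp f)]
        exact MemLp.toLp_congr _ _ (by simp) }
    (by
      obtain ⟨C, hC⟩ := h.continuous
      refine ⟨C, fun f => ?_⟩
      simpa only [LinearMap.coe_mk, AddHom.coe_mk, Lp.norm_toLp] using hC f)

end RKHSpace

end

/-! ### Positive definite matrices and the two barrier potentials. -/

section Barrier

open Matrix
open scoped ComplexOrder

/-! Let `e k` be the right singular vectors of the embedding, so that the functions `e k / σ_k` are
orthonormal in L_2. The sampling method `A` is weighted least squares from the samples onto V =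
span(`e k`, k < m). It reproduces V. The rest of f splits into a middle block f₁ (m ≤ k < N) and a
tail f₂ (k ≥ N). Since f₁ is orthogonal to V in L_2, ‖f₁ - A f₁‖² = ‖f₁‖² + ‖A f₁‖². It remains to
find points and weights whose discrete norm is at least `l` times the L_2 norm (both squared) on V,
is at most a diagonal form on the middle block, and is small on the tail
(`IsSingularSequence.linSamplingNumber_le`).

Such points come from the barrier method of Batson, Spielman and Srivastava
(`exists_points_weights`), run with different families for the two barriers. Each potential is the
trace of an inverse matrix; averaging over D turns the trace inequalities into the existence of a
good next point (`exists_barrier_step`). The upper barrier starts at diag(`q k`) instead of a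
multiple of the identity. Its potential ∑ 1/`q k` replaces the dimension, and `q k` proportional to
1/σ_k² turns it into the tail sum of the σ_k². So the estimate does not depend on N, and the tail
beyond N is paid for by an arbitrarily small part of the potential.

The constant comes from optimizing the barrier speeds: `exists_lower_parameter` gives `l`, and
`exists_barrier_weights` distributes the upper potential between index m and the indices beyond it.
-/

variable {ι : Type*} [Fintype ι]

/-- The real part of the quadratic form of a complex matrix. -/
def Matrix.reQuad {ι : Type*} [Fintype ι] (M : Matrix ι ι ℂ) (v : ι → ℂ) : ℝ :=
  (star v ⬝ᵥ M *ᵥ v).re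

theorem Matrix.reQuad_add (M N : Matrix ι ι ℂ) (v : ι → ℂ) :
    (M + N).reQuad v = M.reQuad v + N.reQuad v := by
  simp [reQuad, add_mulVec, dotProduct_add]

theorem Matrix.reQuad_sub (M N : Matrix ι ι ℂ) (v : ι → ℂ) :
    (M - N).reQuad v = M.reQuad v - N.reQuad v := by
  simp [reQuad, sub_mulVec, dotProduct_sub]

theorem Matrix.reQuad_smul (c : ℝ) (M : Matrix ι ι ℂ) (v : ι → ℂ) :
    (c • M).reQuad v = c * M.reQuad v := by
  simp [reQuad, smul_mulVec, dotProduct_smul]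

theorem Matrix.reQuad_vecMulVec (b v : ι → ℂ) :
    (vecMulVec b (star b)).reQuad v = ‖star b ⬝ᵥ v‖ ^ 2 := by
  rw [reQuad, vecMulVec_mulVec]
  have : star v ⬝ᵥ (MulOpposite.op (star b ⬝ᵥ v) • b) = star (star b ⬝ᵥ v) * (star b ⬝ᵥ v) := by
    rw [dotProduct_smul, star_dotProduct, star_star]
    simp [dotProduct_comm]
  rw [this, Complex.star_def, ← Complex.normSq_eq_conj_mul_self, Complex.sq_norm]
  simp

theorem Matrix.PosSemidef.reQuad_nonneg {M : Matrix ι ι ℂ} (hM : M.PosSemidef) (v : ι → ℂ) :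
    0 ≤ M.reQuad v := hM.re_dotProduct_nonneg v

theorem Matrix.PosDef.reQuad_pos {M : Matrix ι ι ℂ} (hM : M.PosDef) {v : ι → ℂ} (hv : v ≠ 0) :
    0 < M.reQuad v := hM.re_dotProduct_pos hv

theorem Matrix.IsHermitian.coe_reQuad {M : Matrix ι ι ℂ} (hM : M.IsHermitian) (v : ι → ℂ) :
    (M.reQuad v : ℂ) = star v ⬝ᵥ M *ᵥ v := by
  have := hM.im_star_dotProduct_mulVec_self v
  apply Complex.ext
  · simp [reQuad]
  · simpa using this.symm

theorem Matrix.posDef_of_reQuad_pos {M : Matrix ι ι ℂ} (hM : M.IsHermitian)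
    (h : ∀ v ≠ 0, 0 < M.reQuad v) : M.PosDef := by
  refine PosDef.of_dotProduct_mulVec_pos hM fun v hv => ?_
  rw [← hM.coe_reQuad]
  exact_mod_cast h v hv

theorem Matrix.PosSemidef.re_trace_nonneg {M : Matrix ι ι ℂ} (hM : M.PosSemidef) :
    0 ≤ M.trace.re := (Complex.le_def.1 hM.trace_nonneg).1

theorem Matrix.PosDef.re_trace_pos [Nonempty ι] {M : Matrix ι ι ℂ} (hM : M.PosDef) :
    0 < M.trace.re := (Complex.lt_def.1 hM.trace_pos).1

theorem Matrix.re_trace_vecMulVec_star (b : ι → ℂ) :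
    (vecMulVec b (star b)).trace.re = ∑ i, ‖b i‖ ^ 2 := by
  rw [trace_vecMulVec]
  simp [dotProduct, Complex.sq_norm, Complex.normSq_apply]

theorem Matrix.re_trace_smul (c : ℝ) (M : Matrix ι ι ℂ) :
    (c • M).trace.re = c * M.trace.re := by
  simp [trace_smul]

variable [DecidableEq ι]

theorem Matrix.reQuad_one (v : ι → ℂ) : (1 : Matrix ι ι ℂ).reQuad v = ∑ i, ‖v i‖ ^ 2 := by
  simp [reQuad, dotProduct, Complex.sq_norm, Complex.normSq_apply]

/-- The smallest eigenvalue of a positive definite matrix is at least the reciprocal of the trace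
of its inverse. -/
theorem Matrix.PosDef.sum_norm_sq_le {X : Matrix ι ι ℂ} (hX : X.PosDef) (v : ι → ℂ) :
    ∑ i, ‖v i‖ ^ 2 ≤ X⁻¹.trace.re * X.reQuad v := by
  rcases eq_or_ne v 0 with rfl | hv
  · simp [reQuad]
  have hα := hX.reQuad_pos hv
  set α := X.reQuad v with hαdef
  have hu : IsUnit X.det := (isUnit_iff_isUnit_det _).1 hX.isUnit
  -- This matrix is positive semidefinite because Q = Qᴴ X Q; its nonnegative trace is the claim.
  set Q : Matrix ι ι ℂ := X⁻¹ - α⁻¹ • vecMulVec v (star v) with hQ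
  have hQH : Qᴴ = Q := by
    have h1 : X⁻¹ᴴ = X⁻¹ := hX.inv.isHermitian
    rw [hQ, conjTranspose_sub, h1, conjTranspose_smul, conjTranspose_vecMulVec]
    simp
  have hv2 : vecMulVec v (star v) * X * vecMulVec v (star v) = α • vecMulVec v (star v) := by
    rw [vecMulVec_mul, vecMulVec_mul_vecMulVec, ← dotProduct_mulVec, ← hX.isHermitian.coe_reQuad,
      ← hαdef]
    ext i j
    simp [vecMulVec_apply]
    ring
  have hQQ : Q = Qᴴ * X * Q := by
    rw [hQH, hQ, sub_mul, sub_mul, mul_sub, mul_sub, nonsing_inv_mul _ hu, one_mul,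
      smul_mul_assoc, smul_mul_assoc, mul_assoc _ X X⁻¹, mul_nonsing_inv _ hu, mul_one, one_mul,
      mul_smul_comm, smul_mul_assoc, hv2, smul_smul, smul_smul]
    rw [show α⁻¹ * α⁻¹ * α = α⁻¹ by field_simp]
    simp
  have h0 : 0 ≤ Q.trace.re := by
    rw [hQQ]
    exact (hX.posSemidef.conjTranspose_mul_mul_same Q).re_trace_nonneg
  rw [hQ, trace_sub, Complex.sub_re, re_trace_smul, re_trace_vecMulVec_star, sub_nonneg,
    inv_mul_le_iff₀ hα] at h0
  linarith [mul_comm α X⁻¹.trace.re]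

/-- Sherman-Morrison for positive definite matrices. -/
theorem Matrix.PosDef.inv_add_smul_vecMulVec {Y : Matrix ι ι ℂ} (hY : Y.PosDef) (v : ι → ℂ)
    (s : ℝ) (hs : 0 < 1 + s * Y⁻¹.reQuad v) :
    (Y + s • vecMulVec v (star v)).PosDef ∧
    (Y + s • vecMulVec v (star v))⁻¹.trace.re =
      Y⁻¹.trace.re - s / (1 + s * Y⁻¹.reQuad v) * (Y⁻¹ * Y⁻¹).reQuad v := by
  have hu : IsUnit Y.det := (isUnit_iff_isUnit_det _).1 hY.isUnit
  set M := Y⁻¹ with hM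
  have hMH : Mᴴ = M := hY.inv.isHermitian
  set q := M.reQuad v with hq
  set c := s / (1 + s * q) with hc
  set Z : Matrix ι ι ℂ := M - c • vecMulVec (M *ᵥ v) (star (M *ᵥ v)) with hZ
  have hstar : star (M *ᵥ v) = star v ᵥ* M := by rw [star_mulVec, hMH]
  have hYM : Y * M = 1 := mul_nonsing_inv _ hu
  have hprod : (Y + s • vecMulVec v (star v)) * Z = 1 := by
    have h1 : Y * vecMulVec (M *ᵥ v) (star (M *ᵥ v)) = vecMulVec v (star (M *ᵥ v)) := by
      rw [mul_vecMulVec, mulVec_mulVec, hYM, one_mulVec]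
    have h2 : vecMulVec v (star v) * M = vecMulVec v (star (M *ᵥ v)) := by
      rw [vecMulVec_mul, hstar]
    have h3 : vecMulVec v (star v) * vecMulVec (M *ᵥ v) (star (M *ᵥ v)) =
        q • vecMulVec v (star (M *ᵥ v)) := by
      rw [vecMulVec_mul_vecMulVec, ← hY.inv.isHermitian.coe_reQuad]
      ext i j
      simp [vecMulVec_apply, hq, hM]
      ring
    rw [hZ, add_mul, mul_sub, mul_sub, hYM, mul_smul_comm, h1, smul_mul_assoc, h2,
      smul_mul_assoc, mul_smul_comm, h3, smul_smul, smul_smul]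
    have : s - c - s * (c * q) = 0 := by
      rw [hc]; field_simp; ring
    calc _ = 1 + (s - c - s * (c * q)) • vecMulVec v (star (M *ᵥ v)) := by module
      _ = 1 := by rw [this, zero_smul, add_zero]
  have hinv : (Y + s • vecMulVec v (star v))⁻¹ = Z := inv_eq_right_inv hprod
  have hpd : (Y + s • vecMulVec v (star v)).PosDef := by
    rcases le_or_gt 0 s with h | h
    · exact hY.add_posSemidef ((posSemidef_vecMulVec_self_star v).smul h)
    -- For negative `s` positivity is read off the inverse, which is `Y⁻¹` plus a nonnegative
    -- rank-one term.
    · have hZp : Z.PosDef := by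
        rw [hZ, sub_eq_add_neg, ← neg_smul]
        refine hY.inv.add_posSemidef ((posSemidef_vecMulVec_self_star _).smul ?_)
        rw [hc, ← neg_div]
        exact div_nonneg (by linarith) hs.le
      have := hZp.inv
      rwa [inv_eq_left_inv hprod] at this
  refine ⟨hpd, ?_⟩
  rw [hinv, hZ, trace_sub, Complex.sub_re, re_trace_smul, trace_vecMulVec, hstar,
    dotProduct_comm, ← dotProduct_mulVec, mulVec_mulVec]
  rfl


/-- Resolvent identity. Its trace measures how much a potential changes when its barrier moves by
`δ`. -/
theorem Matrix.inv_sub_inv_add_smul_one {P : Matrix ι ι ℂ} (hP : P.PosDef) {δ : ℝ} (hδ : 0 < δ) :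
    P⁻¹ - (P + δ • 1)⁻¹ = δ • ((P + δ • 1)⁻¹ * P⁻¹) := by
  have hQ : (P + δ • (1 : Matrix ι ι ℂ)).PosDef := hP.add_posSemidef (PosSemidef.one.smul hδ.le)
  have huP : IsUnit P.det := (isUnit_iff_isUnit_det _).1 hP.isUnit
  have huQ : IsUnit (P + δ • (1 : Matrix ι ι ℂ)).det := (isUnit_iff_isUnit_det _).1 hQ.isUnit
  set B := (P + δ • (1 : Matrix ι ι ℂ))⁻¹ with hB
  have h1 : B * (P + δ • 1) = 1 := nonsing_inv_mul _ huQ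
  calc P⁻¹ - B = B * (P + δ • 1) * P⁻¹ - B * (P * P⁻¹) := by
        rw [h1, one_mul, mul_nonsing_inv _ huP, mul_one]
    _ = δ • (B * P⁻¹) := by
        rw [mul_add, add_mul, mul_assoc, mul_smul_comm, mul_one, smul_mul_assoc, add_sub_cancel_left]

/-- The product of the commuting matrices `(P + δ)⁻¹` and `P⁻¹` is positive definite. -/
theorem Matrix.posDef_inv_add_smul_one_mul_inv {P : Matrix ι ι ℂ} (hP : P.PosDef) {δ : ℝ}
    (hδ : 0 < δ) : ((P + δ • 1)⁻¹ * P⁻¹).PosDef := by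
  have hQ : (P + δ • (1 : Matrix ι ι ℂ)).PosDef := hP.add_posSemidef (PosSemidef.one.smul hδ.le)
  have huP : IsUnit P.det := (isUnit_iff_isUnit_det _).1 hP.isUnit
  have huQ : IsUnit (P + δ • (1 : Matrix ι ι ℂ)).det := (isUnit_iff_isUnit_det _).1 hQ.isUnit
  have hres := inv_sub_inv_add_smul_one hP hδ
  set B := (P + δ • (1 : Matrix ι ι ℂ))⁻¹ with hB
  set A := P⁻¹ with hA
  have hBH : Bᴴ = B := hQ.inv.isHermitian
  -- Since `A` and `B` commute, the product becomes a sum of visibly Hermitian terms, one definite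
  -- and one semidefinite.
  have hAB : B * A = B * B + δ • (B * A * B) := by
    have h2 : A = B + δ • (B * A) := by rw [← hres]; abel
    have hcomm : B * (B * A) = B * A * B := by
      have h4 : B * (A - B) = (A - B) * B := by
        have h5 : A * B = B * A := by
          have h6 : A * (P + δ • 1) = (P + δ • 1) * A := by
            rw [mul_add, add_mul, hA, nonsing_inv_mul _ huP, mul_nonsing_inv _ huP,
              mul_smul_comm, smul_mul_assoc, mul_one, one_mul]
          calc A * B = B * ((P + δ • 1) * A) * B := by
                rw [← mul_assoc B, hB, nonsing_inv_mul _ huQ, one_mul]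
            _ = B * (A * ((P + δ • 1) * B)) := by rw [← h6, mul_assoc, mul_assoc]
            _ = B * A := by rw [hB, mul_nonsing_inv _ huQ, mul_one]
        rw [mul_sub, sub_mul, h5]
      rw [hres, mul_smul_comm, smul_mul_assoc] at h4
      exact smul_right_injective _ hδ.ne' h4
    calc B * A = B * (B + δ • (B * A)) := by rw [← h2]
      _ = _ := by rw [mul_add, mul_smul_comm, hcomm]
  rw [hAB]
  refine PosDef.add_posSemidef ?_ ?_
  · have := PosDef.conjTranspose_mul_self B (mulVec_injective_iff_isUnit.2 hQ.inv.isUnit)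
    rwa [hBH] at this
  · have := hP.inv.posSemidef.conjTranspose_mul_mul_same B
    rw [hBH] at this
    exact this.smul hδ.le

/-- Averaged lower barrier inequality. -/
theorem Matrix.lower_barrier_average [Nonempty ι] {P : Matrix ι ι ℂ} (hP : P.PosDef) {δ ε : ℝ}
    (hδ : 0 < δ) (hδε : δ * ε ≤ 1) (hε : (P + δ • 1)⁻¹.trace.re ≤ ε) :
    0 < P⁻¹.trace.re - (P + δ • 1)⁻¹.trace.re ∧
    1 / δ - ε ≤ (P⁻¹ * P⁻¹).trace.re / (P⁻¹.trace.re - (P + δ • 1)⁻¹.trace.re)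
      - P⁻¹.trace.re := by
  have hQ : (P + δ • (1 : Matrix ι ι ℂ)).PosDef := hP.add_posSemidef (PosSemidef.one.smul hδ.le)
  have hres := inv_sub_inv_add_smul_one hP hδ
  have hBA := posDef_inv_add_smul_one_mul_inv hP hδ
  set B := (P + δ • (1 : Matrix ι ι ℂ))⁻¹ with hB
  set A := P⁻¹ with hA
  have hAH : Aᴴ = A := hP.inv.isHermitian
  set h := (B * A).trace.re with hh
  have hpos : 0 < h := hBA.re_trace_pos
  have hgap : A.trace.re - B.trace.re = δ * h := by
    rw [← Complex.sub_re, ← trace_sub, hres, re_trace_smul]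
  have hAB : (A * B).trace.re = h := by rw [trace_mul_comm]
  set T := (A * B * A).trace.re with hT
  have hsq : (A * A).trace.re = h + δ * T := by
    have : A * A = A * B + δ • (A * (B * A)) := by
      rw [← mul_smul_comm, ← hres, mul_sub]; abel
    rw [this, trace_add, Complex.add_re, re_trace_smul, hAB, ← mul_assoc]
  -- Cauchy-Schwarz for the form tr(Xᴴ B Y), in the shape of its positivity at A - δh.
  have hquad : 0 ≤ T - 2 * (δ * h) * h + (δ * h) ^ 2 * B.trace.re := by
    have h1 := (hQ.inv.posSemidef.conjTranspose_mul_mul_same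
      (A - (δ * h) • (1 : Matrix ι ι ℂ))).re_trace_nonneg
    have h2 : (A - (δ * h) • (1 : Matrix ι ι ℂ))ᴴ * B * (A - (δ * h) • (1 : Matrix ι ι ℂ)) =
        A * B * A - (δ * h) • (B * A) - (δ * h) • (A * B) + (δ * h) ^ 2 • B := by
      rw [conjTranspose_sub, hAH, conjTranspose_smul, conjTranspose_one, sub_mul, sub_mul, mul_sub,
        mul_sub]
      simp only [star_trivial, smul_mul_assoc, mul_smul_comm, one_mul, mul_one, smul_smul]
      module
    rw [h2, trace_add, trace_sub, trace_sub, Complex.add_re, Complex.sub_re, Complex.sub_re,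
      re_trace_smul, re_trace_smul, re_trace_smul, hAB] at h1
    linarith
  have hTge : δ * h ^ 2 ≤ T := by
    have : δ * B.trace.re ≤ 1 := (mul_le_mul_of_nonneg_left hε hδ.le).trans hδε
    have h3 : δ * h ^ 2 * (δ * B.trace.re) ≤ δ * h ^ 2 * 1 :=
      mul_le_mul_of_nonneg_left this (by positivity)
    linarith
  rw [hgap, hsq]
  refine ⟨by positivity, ?_⟩
  have h4 : (h + δ * T) / (δ * h) = 1 / δ + T / h := by field_simp
  have h5 : δ * h ≤ T / h := by rw [le_div_iff₀ hpos]; linarith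
  rw [h4]
  linarith

/-- Averaged upper barrier inequality. -/
theorem Matrix.upper_barrier_average {P : Matrix ι ι ℂ} (hP : P.PosDef) {δ : ℝ} (hδ : 0 < δ) :
    (P + δ • 1)⁻¹.trace.re ≤ P⁻¹.trace.re ∧
    ((P + δ • 1)⁻¹ * (P + δ • 1)⁻¹).trace.re / (P⁻¹.trace.re - (P + δ • 1)⁻¹.trace.re)
      + (P + δ • 1)⁻¹.trace.re ≤ 1 / δ + P⁻¹.trace.re := by
  have hQ : (P + δ • (1 : Matrix ι ι ℂ)).PosDef := hP.add_posSemidef (PosSemidef.one.smul hδ.le)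
  have hres := inv_sub_inv_add_smul_one hP hδ
  have hBA := posDef_inv_add_smul_one_mul_inv hP hδ
  set B := (P + δ • (1 : Matrix ι ι ℂ))⁻¹ with hB
  set A := P⁻¹ with hA
  have hBH : Bᴴ = B := hQ.inv.isHermitian
  set h := (B * A).trace.re with hh
  have hpos : 0 ≤ h := hBA.posSemidef.re_trace_nonneg
  have hgap : A.trace.re - B.trace.re = δ * h := by
    rw [← Complex.sub_re, ← trace_sub, hres, re_trace_smul]
  have hsq : (B * B).trace.re ≤ h := by
    have h1 : B * A = B * B + δ • (B * (B * A)) := by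
      rw [← mul_smul_comm, ← hres, mul_sub]; abel
    have h2 := (hP.inv.posSemidef.conjTranspose_mul_mul_same B).re_trace_nonneg
    rw [hBH, ← hA, trace_mul_cycle, mul_assoc] at h2
    have h3 := congrArg (fun M => M.trace.re) h1
    simp only [trace_add, Complex.add_re, re_trace_smul] at h3
    have := mul_nonneg hδ.le h2
    linarith
  have hgap' : 0 ≤ δ * h := by positivity
  refine ⟨by linarith, ?_⟩
  rw [hgap]
  have h4 : (B * B).trace.re / (δ * h) ≤ 1 / δ := by
    rcases hpos.eq_or_lt with h0 | h0
    · rw [← h0]; simp [hδ.le]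
    · rw [div_le_div_iff₀ (by positivity) hδ]
      nlinarith
  linarith

/-- By Sherman-Morrison the rank-one term lowers the trace by t·b*P⁻²b / (1 + t·b*P⁻¹b), and `hb`
says that this is at least `g`. In the application `g` is the increase caused by moving the barrier.
-/
theorem Matrix.lower_barrier_update {P : Matrix ι ι ℂ} (hP : P.PosDef) {g t : ℝ} (hg : 0 < g)
    (ht : 0 < t) (b : ι → ℂ) (hb : t⁻¹ ≤ (P⁻¹ * P⁻¹).reQuad b / g - P⁻¹.reQuad b) :
    (P + t • vecMulVec b (star b)).PosDef ∧
    (P + t • vecMulVec b (star b))⁻¹.trace.re ≤ P⁻¹.trace.re - g := by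
  have hq := hP.inv.posSemidef.reQuad_nonneg b
  have hs : 0 < 1 + t * P⁻¹.reQuad b := by positivity
  obtain ⟨h1, h2⟩ := hP.inv_add_smul_vecMulVec b t hs
  refine ⟨h1, ?_⟩
  rw [h2]
  have h3 : g * (t⁻¹ + P⁻¹.reQuad b) ≤ (P⁻¹ * P⁻¹).reQuad b := by
    rw [← le_div_iff₀' hg]; linarith
  have h4 : g ≤ t / (1 + t * P⁻¹.reQuad b) * (P⁻¹ * P⁻¹).reQuad b := by
    calc g = t / (1 + t * P⁻¹.reQuad b) * (g * (t⁻¹ + P⁻¹.reQuad b)) := by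
          field_simp
      _ ≤ _ := mul_le_mul_of_nonneg_left h3 (by positivity)
  linarith

/-- Mirror image of the lower update: the shift by `δ` gains more potential than the subtraction
costs. The strict inequality keeps the Sherman-Morrison denominator positive. -/
theorem Matrix.upper_barrier_update {P : Matrix ι ι ℂ} (hP : P.PosDef) {δ t : ℝ} (hδ : 0 < δ)
    (ht : 0 < t) (c : ι → ℂ)
    (hc : ((P + δ • 1)⁻¹ * (P + δ • 1)⁻¹).reQuad c /
      (P⁻¹.trace.re - (P + δ • 1)⁻¹.trace.re) + (P + δ • 1)⁻¹.reQuad c < t⁻¹) :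
    (P + δ • 1 - t • vecMulVec c (star c)).PosDef ∧
    (P + δ • 1 - t • vecMulVec c (star c))⁻¹.trace.re ≤ P⁻¹.trace.re := by
  -- Over an empty index type the gap in the denominator of `hc` is 0.
  rcases isEmpty_or_nonempty ι with hι | hι
  · refine ⟨?_, by simp [trace]⟩
    rw [Subsingleton.elim (P + δ • 1 - t • vecMulVec c (star c)) 1]
    exact PosDef.one
  have hQ : (P + δ • (1 : Matrix ι ι ℂ)).PosDef := hP.add_posSemidef (PosSemidef.one.smul hδ.le)
  have hres := inv_sub_inv_add_smul_one hP hδ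
  have hBA := posDef_inv_add_smul_one_mul_inv hP hδ
  set Q := P + δ • (1 : Matrix ι ι ℂ) with hQdef
  have hgap : P⁻¹.trace.re - Q⁻¹.trace.re = δ * (Q⁻¹ * P⁻¹).trace.re := by
    rw [← Complex.sub_re, ← trace_sub, hres, re_trace_smul]
  have hg : 0 < P⁻¹.trace.re - Q⁻¹.trace.re := by
    rw [hgap]; exact mul_pos hδ hBA.re_trace_pos
  set g := P⁻¹.trace.re - Q⁻¹.trace.re with hgdef
  have hqq : 0 ≤ (Q⁻¹ * Q⁻¹).reQuad c := by
    have := posSemidef_conjTranspose_mul_self Q⁻¹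
    rw [hQ.inv.isHermitian] at this
    exact this.reQuad_nonneg c
  have h0 : Q⁻¹.reQuad c < t⁻¹ := by
    have := div_nonneg hqq hg.le
    linarith
  have hs : 0 < 1 + -t * Q⁻¹.reQuad c := by
    have := mul_lt_mul_of_pos_left h0 ht
    rw [mul_inv_cancel₀ ht.ne'] at this
    linarith
  obtain ⟨h1, h2⟩ := hQ.inv_add_smul_vecMulVec c (-t) hs
  rw [neg_smul, ← sub_eq_add_neg] at h1 h2
  refine ⟨h1, ?_⟩
  rw [h2]
  have h3 : (Q⁻¹ * Q⁻¹).reQuad c ≤ g * (t⁻¹ - Q⁻¹.reQuad c) := by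
    rw [← div_le_iff₀' hg]; linarith
  have h4 : t / (1 + -t * Q⁻¹.reQuad c) * (Q⁻¹ * Q⁻¹).reQuad c ≤ g := by
    calc _ ≤ t / (1 + -t * Q⁻¹.reQuad c) * (g * (t⁻¹ - Q⁻¹.reQuad c)) :=
          mul_le_mul_of_nonneg_left h3 (by positivity)
      _ = g * (t * (t⁻¹ - Q⁻¹.reQuad c)) / (1 + -t * Q⁻¹.reQuad c) := by ring
      _ = g := by
        rw [show t * (t⁻¹ - Q⁻¹.reQuad c) = 1 + -t * Q⁻¹.reQuad c by
          rw [mul_sub, mul_inv_cancel₀ ht.ne']; ring]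
        exact mul_div_cancel_right₀ g hs.ne'
  rw [neg_div, neg_mul]
  linarith

end Barrier

/-! ### Averaging over D and the choice of points and weights. -/

section Isotropic

open Matrix
open scoped ComplexOrder

variable {D : Type*} [MeasurableSpace D]

/-- The family `b i : D → ℂ` is orthonormal in `L_2(D, μ)`. -/
def IsotropicFamily (μ : Measure D) {ι : Type*} [DecidableEq ι] (b : D → ι → ℂ) : Prop :=
  ∀ i j, Integrable (fun x => star (b x i) * b x j) μ ∧
    ∫ x, star (b x i) * b x j ∂μ = if i = j then 1 else 0

variable {μ : Measure D} {ι κ : Type*} [Fintype ι] [DecidableEq ι] [Fintype κ] [DecidableEq κ]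

/-- The rank-one matrices of an orthonormal family integrate to the identity. This turns the trace
inequalities of the barriers into statements about averages over D. -/
theorem IsotropicFamily.integral_reQuad {b : D → ι → ℂ} (hb : IsotropicFamily μ b)
    (M : Matrix ι ι ℂ) :
    Integrable (fun x => M.reQuad (b x)) μ ∧ ∫ x, M.reQuad (b x) ∂μ = M.trace.re := by
  have hexp : ∀ x, star (b x) ⬝ᵥ M *ᵥ b x = ∑ i, ∑ j, M i j * (star (b x i) * b x j) := by
    intro x
    simp only [dotProduct, mulVec, Finset.mul_sum, Pi.star_apply]
    exact Finset.sum_congr rfl fun i _ => Finset.sum_congr rfl fun j _ => by ring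
  have hint : Integrable (fun x => star (b x) ⬝ᵥ M *ᵥ b x) μ := by
    simp only [hexp]
    exact integrable_finsetSum _ fun i _ => integrable_finsetSum _ fun j _ =>
      ((hb i j).1.const_mul _)
  refine ⟨hint.re, ?_⟩
  have h1 : ∫ x, M.reQuad (b x) ∂μ = (∫ x, star (b x) ⬝ᵥ M *ᵥ b x ∂μ).re := integral_re hint
  rw [h1]
  congr 1
  simp only [hexp]
  refine (integral_finsetSum _ fun i _ => integrable_finsetSum _ fun j _ =>
      ((hb i j).1.const_mul (M i j))).trans ?_
  simp only [trace, diag]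
  refine Finset.sum_congr rfl fun i _ => ?_
  refine (integral_finsetSum _ fun j _ => ((hb i j).1.const_mul (M i j))).trans ?_
  simp only [integral_const_mul, (hb i _).2]
  simp

omit [DecidableEq ι] in
theorem Matrix.reQuad_sum_smul_vecMulVec {η : Type*} [Fintype η] (t : η → ℝ) (d : η → ι → ℂ)
    (v : ι → ℂ) : (∑ i, t i • vecMulVec (d i) (star (d i))).reQuad v =
      ∑ i, t i * ‖star (d i) ⬝ᵥ v‖ ^ 2 := by
  rw [reQuad, sum_mulVec, dotProduct_sum, Complex.re_sum]
  refine Finset.sum_congr rfl fun i _ => ?_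
  rw [← reQuad_vecMulVec, ← reQuad_smul, reQuad]

/-- One step of the barrier argument: there are a point and a weight that keep both barriers. -/
theorem exists_barrier_step [Nonempty ι] {b : D → ι → ℂ} {c : D → κ → ℂ}
    (hb : IsotropicFamily μ b) (hc : IsotropicFamily μ c) {P : Matrix ι ι ℂ} (hP : P.PosDef)
    {Q : Matrix κ κ ℂ} (hQ : Q.PosDef) {ε φ : ℝ} (hε : 0 < ε) (hφ1 : φ < 1)
    (hPε : P⁻¹.trace.re ≤ ε) {R : D → ℝ} (hR : ∀ x, 0 ≤ R x) (hRi : Integrable R μ)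
    (hQφ : Q⁻¹.trace.re + ∫ x, R x ∂μ < φ) :
    ∃ (x : D) (t : ℝ), 0 < t ∧
      (P - (1 / (1 + ε)) • 1 + t • vecMulVec (b x) (star (b x))).PosDef ∧
      (P - (1 / (1 + ε)) • 1 + t • vecMulVec (b x) (star (b x)))⁻¹.trace.re ≤ ε ∧
      (Q + (1 / (1 - φ)) • 1 - t • vecMulVec (c x) (star (c x))).PosDef ∧
      (Q + (1 / (1 - φ)) • 1 - t • vecMulVec (c x) (star (c x)))⁻¹.trace.re ≤ Q⁻¹.trace.re ∧
      t * R x ≤ 1 := by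
  -- The speeds are such that 1/δ - ε = 1 bounds the lower average from below and 1/δ' = 1 - φ
  -- enters the bound for the upper average.
  set δ := 1 / (1 + ε) with hδ
  have hδ0 : 0 < δ := by positivity
  have hδε : δ * ε < 1 := by rw [hδ, one_div, inv_mul_lt_iff₀ (by positivity)]; linarith
  set δ' := 1 / (1 - φ) with hδ'
  have hδ'0 : 0 < δ' := one_div_pos.2 (by linarith)
  set P' := P - δ • (1 : Matrix ι ι ℂ) with hP'
  have hPP' : P' + δ • 1 = P := by simp [hP']
  -- The smallest eigenvalue of `P` is at least 1/ε, which exceeds δ = 1/(1 + ε).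
  have hP'pd : P'.PosDef := by
    refine posDef_of_reQuad_pos (hP.isHermitian.sub ?_) fun v hv => ?_
    · rw [IsHermitian, conjTranspose_smul, conjTranspose_one, star_trivial]
    · have h1 := hP.sum_norm_sq_le v
      rw [hP', reQuad_sub, reQuad_smul, reQuad_one]
      have h2 := hP.reQuad_pos hv
      have h3 : P⁻¹.trace.re * P.reQuad v ≤ ε * P.reQuad v :=
        mul_le_mul_of_nonneg_right hPε h2.le
      have h4 : δ * ∑ i, ‖v i‖ ^ 2 ≤ δ * (ε * P.reQuad v) :=
        mul_le_mul_of_nonneg_left (h1.trans h3) hδ0.le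
      nlinarith
  obtain ⟨hg, hL⟩ := lower_barrier_average hP'pd hδ0 hδε.le (by rwa [hPP'])
  rw [hPP'] at hg hL
  obtain ⟨-, hU⟩ := upper_barrier_average hQ hδ'0
  set g := P'⁻¹.trace.re - P⁻¹.trace.re with hgdef
  set Q' := Q + δ' • (1 : Matrix κ κ ℂ) with hQ'
  have hQ'pd : Q'.PosDef := hQ.add_posSemidef (PosSemidef.one.smul hδ'0.le)
  set g' := Q⁻¹.trace.re - Q'⁻¹.trace.re with hg'def
  let lo : D → ℝ := fun x => (P'⁻¹ * P'⁻¹).reQuad (b x) / g - P'⁻¹.reQuad (b x)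
  let up : D → ℝ := fun x => (Q'⁻¹ * Q'⁻¹).reQuad (c x) / g' + Q'⁻¹.reQuad (c x)
  have hg'0 : 0 ≤ g' := sub_nonneg.2 (upper_barrier_average hQ hδ'0).1
  have hup0 : ∀ x, 0 ≤ up x := fun x => by
    have h1 := posSemidef_conjTranspose_mul_self Q'⁻¹
    rw [hQ'pd.inv.isHermitian] at h1
    exact add_nonneg (div_nonneg (h1.reQuad_nonneg _) hg'0)
      (hQ'pd.inv.posSemidef.reQuad_nonneg _)
  have hb1 := hb.integral_reQuad (P'⁻¹ * P'⁻¹)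
  have hb2 := hb.integral_reQuad P'⁻¹
  have hc1 := hc.integral_reQuad (Q'⁻¹ * Q'⁻¹)
  have hc2 := hc.integral_reQuad Q'⁻¹
  have hloi : Integrable lo μ := (hb1.1.div_const g).sub hb2.1
  have hupi : Integrable up μ := (hc1.1.div_const g').add hc2.1
  have hlo : 1 ≤ ∫ x, lo x ∂μ := by
    have : ∫ x, lo x ∂μ = (P'⁻¹ * P'⁻¹).trace.re / g - P'⁻¹.trace.re := by
      simp only [lo]
      rw [integral_sub (hb1.1.div_const g) hb2.1, integral_div, hb1.2, hb2.2]
    rw [this]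
    refine le_trans ?_ hL
    rw [hδ, one_div_one_div]
    linarith
  have hup : ∫ x, up x ∂μ ≤ 1 - φ + Q⁻¹.trace.re := by
    have : ∫ x, up x ∂μ = (Q'⁻¹ * Q'⁻¹).trace.re / g' + Q'⁻¹.trace.re := by
      simp only [up]
      rw [integral_add (hc1.1.div_const g') hc2.1, integral_div, hc1.2, hc2.2]
    rw [this]
    refine hU.trans ?_
    rw [hδ', one_div_one_div]
  -- The left side has integral less than 1, the right side at least 1.
  obtain ⟨x, hx⟩ : ∃ x, up x + R x < lo x := by
    by_contra! h
    have h1 := integral_mono hloi (hupi.add hRi) h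
    rw [integral_add' hupi hRi] at h1
    linarith
  have hlox : 0 < lo x := by linarith [hup0 x, hR x]
  -- The smallest weight that the lower barrier admits; `up` and `R` leave room for it.
  refine ⟨x, (lo x)⁻¹, inv_pos.2 hlox, ?_⟩
  obtain ⟨h1, h2⟩ := lower_barrier_update hP'pd hg (inv_pos.2 hlox) (b x) (by rw [inv_inv])
  obtain ⟨h3, h4⟩ := upper_barrier_update hQ hδ'0 (inv_pos.2 hlox) (c x)
    (by rw [inv_inv]; change up x < lo x; linarith [hR x])
  refine ⟨h1, h2.trans ?_, h3, h4, ?_⟩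
  · rw [hgdef]; linarith
  · rw [inv_mul_le_iff₀ hlox]; linarith [hup0 x]

/-- Weighted sampling points with a two-sided discretization property (after Batson, Spielman and
Srivastava). -/
theorem exists_points_weights [Nonempty ι] {b : D → ι → ℂ} {c : D → κ → ℂ}
    (hb : IsotropicFamily μ b) (hc : IsotropicFamily μ c) {m : ℕ} (hm : Fintype.card ι ≤ m)
    {ε φ : ℝ} (hε : 0 < ε) (hφ0 : 0 < φ) (hφ1 : φ < 1) {q : κ → ℝ} (hq : ∀ k, 0 < q k)
    {R : D → ℝ} (hR : ∀ x, 0 ≤ R x) (hRi : Integrable R μ)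
    (hqφ : ∑ k, 1 / q k + ∫ x, R x ∂μ < φ) (n : ℕ) :
    ∃ (x : Fin n → D) (t : Fin n → ℝ), (∀ i, 0 < t i) ∧
      (∀ v : ι → ℂ, (n / (1 + ε) - (m - 1) / ε) * ∑ j, ‖v j‖ ^ 2 ≤
        ∑ i, t i * ‖star (b (x i)) ⬝ᵥ v‖ ^ 2) ∧
      (∀ v : κ → ℂ, ∑ i, t i * ‖star (c (x i)) ⬝ᵥ v‖ ^ 2 ≤
        ∑ k, (q k + n / (1 - φ) - 1 / φ) * ‖v k‖ ^ 2) ∧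
      ∑ i, t i * R (x i) ≤ n := by
  set Q₀ : Matrix κ κ ℂ := diagonal fun k => (q k : ℂ) with hQ₀
  have hQ₀pd : Q₀.PosDef := PosDef.diagonal fun k => by exact_mod_cast hq k
  have hQ₀tr : Q₀⁻¹.trace.re = ∑ k, 1 / q k := by
    have : Q₀⁻¹ = diagonal fun k => ((1 / q k : ℝ) : ℂ) := by
      apply inv_eq_right_inv
      rw [hQ₀, diagonal_mul_diagonal, ← diagonal_one]
      congr 1
      ext k
      have : (q k : ℂ) ≠ 0 := by exact_mod_cast (hq k).ne'
      push_cast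
      field_simp
    rw [this, trace_diagonal, Complex.re_sum]
    simp
  have hm0 : 0 < (m : ℝ) := by exact_mod_cast Fintype.card_pos.trans_le hm
  have hP₀pd : (((m : ℝ) / ε) • (1 : Matrix ι ι ℂ)).PosDef := PosDef.one.smul (by positivity)
  have hP₀tr : (((m : ℝ) / ε) • (1 : Matrix ι ι ℂ))⁻¹.trace.re ≤ ε := by
    have : (((m : ℝ) / ε) • (1 : Matrix ι ι ℂ))⁻¹ = (ε / m) • 1 := by
      apply inv_eq_right_inv
      rw [smul_mul_assoc, one_mul, smul_smul, div_mul_div_comm, mul_comm ε, div_self (by positivity),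
        one_smul]
    rw [this, re_trace_smul, trace_one]
    have h : (Fintype.card ι : ℝ) ≤ m := by exact_mod_cast hm
    rw [Complex.natCast_re, div_mul_eq_mul_div, div_le_iff₀ hm0]
    exact mul_le_mul_of_nonneg_left h hε.le
  -- After `j` points the lower barrier stands at j/(1 + ε) - m/ε and the upper one at `Q₀` + j/(1 -
  -- φ). The start -m/ε makes the first lower potential at most `ε`.
  have key : ∀ j : ℕ, ∃ (x : Fin j → D) (t : Fin j → ℝ), (∀ i, 0 < t i) ∧
      ((m / ε - j * (1 / (1 + ε))) • 1 +
        ∑ i, t i • vecMulVec (b (x i)) (star (b (x i)))).PosDef ∧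
      ((m / ε - j * (1 / (1 + ε))) • 1 +
        ∑ i, t i • vecMulVec (b (x i)) (star (b (x i))))⁻¹.trace.re ≤ ε ∧
      (Q₀ + (j * (1 / (1 - φ))) • 1 -
        ∑ i, t i • vecMulVec (c (x i)) (star (c (x i)))).PosDef ∧
      (Q₀ + (j * (1 / (1 - φ))) • 1 -
        ∑ i, t i • vecMulVec (c (x i)) (star (c (x i))))⁻¹.trace.re ≤ ∑ k, 1 / q k ∧
      ∑ i, t i * R (x i) ≤ j := by
    intro j
    induction j with
    | zero =>
      refine ⟨Fin.elim0, Fin.elim0, fun i => i.elim0, ?_⟩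
      simpa [hQ₀pd] using ⟨hP₀pd, hP₀tr, (hQ₀tr.le.trans (by simp))⟩
    | succ j ih =>
      obtain ⟨x, t, ht, hP, hPε, hQ, hQq, hRj⟩ := ih
      obtain ⟨y, s, hs, h1, h2, h3, h4, h5⟩ := exists_barrier_step hb hc hP hQ hε hφ1 hPε hR hRi
        (by linarith)
      refine ⟨Fin.snoc x y, Fin.snoc t s, ?_, ?_⟩
      · intro i
        refine Fin.lastCases ?_ (fun i => ?_) i
        · simpa using hs
        · simpa using ht i
      · simp only [Fin.sum_univ_castSucc, Fin.snoc_castSucc, Fin.snoc_last]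
        have e1 : ((m / ε - ((j + 1 : ℕ) : ℝ) * (1 / (1 + ε))) • (1 : Matrix ι ι ℂ)) +
            (∑ i, t i • vecMulVec (b (x i)) (star (b (x i))) +
              s • vecMulVec (b y) (star (b y))) =
            (m / ε - j * (1 / (1 + ε))) • 1 +
              ∑ i, t i • vecMulVec (b (x i)) (star (b (x i))) - (1 / (1 + ε)) • 1 +
              s • vecMulVec (b y) (star (b y)) := by
          push_cast; module
        have e2 : Q₀ + (((j + 1 : ℕ) : ℝ) * (1 / (1 - φ))) • (1 : Matrix κ κ ℂ) -
            (∑ i, t i • vecMulVec (c (x i)) (star (c (x i))) +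
              s • vecMulVec (c y) (star (c y))) =
            Q₀ + (j * (1 / (1 - φ))) • 1 -
              ∑ i, t i • vecMulVec (c (x i)) (star (c (x i))) + (1 / (1 - φ)) • 1 -
              s • vecMulVec (c y) (star (c y)) := by
          push_cast; module
        rw [e1, e2]
        refine ⟨h1, h2, h3, h4.trans hQq, ?_⟩
        push_cast
        linarith
  obtain ⟨x, t, ht, hP, hPε, hQ, hQq, hRn⟩ := key n
  refine ⟨x, t, ht, fun v => ?_, fun v => ?_, hRn⟩
  · rcases eq_or_ne v 0 with rfl | hv
    · simp
    -- The matrix stays 1/ε above its barrier, since its inverse has trace at most `ε`; this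
    -- improves m/ε to (m - 1)/ε.
    have h1 := hP.sum_norm_sq_le v
    have h2 := (h1.trans (mul_le_mul_of_nonneg_right hPε (hP.reQuad_pos hv).le))
    rw [reQuad_add, reQuad_sum_smul_vecMulVec, reQuad_smul, reQuad_one] at h2
    rw [← div_le_iff₀' hε] at h2
    have : (n / (1 + ε) - (m - 1) / ε) * ∑ j, ‖v j‖ ^ 2 =
      (∑ j, ‖v j‖ ^ 2) / ε - (m / ε - n * (1 / (1 + ε))) * ∑ j, ‖v j‖ ^ 2 := by ring
    linarith
  · rcases eq_or_ne v 0 with rfl | hv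
    · simp
    have hint : 0 ≤ ∫ x, R x ∂μ := integral_nonneg hR
    -- The same gain at the upper barrier yields the term -1/φ.
    have h1 := hQ.sum_norm_sq_le v
    have h2 := (h1.trans (mul_le_mul_of_nonneg_right (hQq.trans (by linarith : _ ≤ φ))
      (hQ.reQuad_pos hv).le))
    rw [reQuad_sub, reQuad_add, reQuad_sum_smul_vecMulVec, reQuad_smul, reQuad_one, ← div_le_iff₀' hφ0] at h2
    have h3 : Q₀.reQuad v = ∑ k, q k * ‖v k‖ ^ 2 := by
      rw [reQuad, dotProduct, Complex.re_sum]
      refine Finset.sum_congr rfl fun k _ => ?_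
      rw [hQ₀, mulVec_diagonal, Pi.star_apply, Complex.sq_norm, Complex.normSq_apply]
      simp
      ring
    have h4 : ∑ k, (q k + n / (1 - φ) - 1 / φ) * ‖v k‖ ^ 2 =
        ∑ k, q k * ‖v k‖ ^ 2 + n * (1 / (1 - φ)) * ∑ k, ‖v k‖ ^ 2 - (∑ k, ‖v k‖ ^ 2) / φ := by
      rw [Finset.mul_sum, Finset.sum_div, ← Finset.sum_add_distrib, ← Finset.sum_sub_distrib]
      exact Finset.sum_congr rfl fun k _ => by ring
    linarith

end Isotropic

/-! ### Singular value decomposition of an injective Hilbert-Schmidt operator. -/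

section SingularSequence

open Filter Topology

/-- A summable family of positive numbers can be enumerated in decreasing order. -/
theorem exists_decreasing_rank {ι : Type*} {a : ι → ℝ} (ha : ∀ i, 0 < a i) (hs : Summable a) :
    ∃ r : ι → ℕ, Function.Injective r ∧ (∀ i j, r i < r j → a j ≤ a i) ∧
      ∀ i k, k < r i → ∃ j, r j = k := by
  have hcount : Countable ι := by
    have := hs.countable_support
    rw [show Function.support a = Set.univ from Set.eq_univ_of_forall fun i => (ha i).ne'] at this
    exact Set.countable_univ_iff.1 this
  obtain ⟨c, hc⟩ := exists_injective_nat ι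
  -- Larger values come first and ties are broken by an enumeration; the rank is the number of
  -- predecessors, finite by summability.
  let key : ι → ℝᵒᵈ ×ₗ ℕ := fun i => toLex (OrderDual.toDual (a i), c i)
  have hkey : Function.Injective key := fun i j h => hc (by
    have := congrArg (fun p => (ofLex p).2) h
    exact this)
  have hle : ∀ i j, key i ≤ key j → a j ≤ a i := fun i j h => by
    rcases Prod.Lex.le_iff.1 h with h | h
    · exact (OrderDual.toDual_lt_toDual.1 h).le
    · exact (congrArg OrderDual.ofDual h.1).ge
  let A : ι → Set ι := fun i => {j | key j < key i}
  have hfin : ∀ i, (A i).Finite := fun i => by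
    have h1 : ∀ᶠ j in cofinite, a j < a i :=
      hs.tendsto_cofinite_zero.eventually (gt_mem_nhds (ha i))
    refine (Filter.eventually_cofinite.1 h1).subset fun j hj => ?_
    exact not_lt.2 (hle j i (le_of_lt hj))
  have hmono : ∀ i j, key i < key j → (A i).ncard < (A j).ncard := fun i j h => by
    refine Set.ncard_lt_ncard ?_ (hfin j)
    refine Set.ssubset_iff_subset_ne.2 ⟨fun k hk => lt_trans hk h, fun he => ?_⟩
    have : i ∈ A i := by rw [he]; exact h
    exact lt_irrefl (key i) this
  have hinj : Function.Injective fun i => (A i).ncard := fun i j h => by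
    rcases lt_trichotomy (key i) (key j) with h1 | h1 | h1
    · exact absurd h (hmono i j h1).ne
    · exact hkey h1
    · exact absurd h (hmono j i h1).ne'
  refine ⟨fun i => (A i).ncard, hinj, fun i j h => hle i j ?_, fun i k hk => ?_⟩
  · by_contra! h1
    exact lt_asymm h (hmono j i h1)
  -- The predecessors of `i` have distinct ranks below that of `i`, and there are as many of them as
  -- there are such numbers.
  · have himg : (fun j => (A j).ncard) '' A i = Set.Iio (A i).ncard := by
      refine Set.eq_of_subset_of_ncard_le ?_ ?_ (Set.finite_Iio _)
      · rintro _ ⟨j, hj, rfl⟩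
        exact hmono j i hj
      · rw [Set.ncard_image_of_injective _ hinj, Set.ncard_eq_toFinset_card']
        simp
    obtain ⟨j, -, hj⟩ := himg.symm ▸ (show k ∈ Set.Iio (A i).ncard from hk)
    exact ⟨j, hj⟩

universe u

variable {E : Type u} {F : Type*} [NormedAddCommGroup E] [InnerProductSpace ℂ E] [CompleteSpace E]
  [NormedAddCommGroup F] [InnerProductSpace ℂ F] [CompleteSpace F]

omit [CompleteSpace E] in
/-- A Hilbert-Schmidt operator is compact. -/
theorem isCompactOperator_of_summable {ι : Type*} (b : HilbertBasis ι ℂ E) (T : E →L[ℂ] F)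
    (hs : Summable fun i => ‖T (b i)‖ ^ 2) : IsCompactOperator T := by
  let G : Finset ι → E →L[ℂ] F := fun s => ∑ i ∈ s, (innerSL ℂ (b i)).smulRight (T (b i))
  classical
  have hG : ∀ s f, G s f = ∑ i ∈ s, ⟪b i, f⟫_ℂ • T (b i) := fun s f => by
    simp [G]
  have hGc : ∀ s, IsCompactOperator (G s) := fun s => by
    have : G s ∈ compactOperator (RingHom.id ℂ) E F := by
      refine Submodule.sum_mem _ fun i _ => ?_
      change IsCompactOperator ((innerSL ℂ (b i)).smulRight (T (b i)))
      exact (isCompactOperator_id.clm_comp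
        (ContinuousLinearMap.toSpanSingleton ℂ (T (b i)))).comp_clm (innerSL ℂ (b i))
    exact this
  -- The finite-rank truncations converge in operator norm, by Cauchy-Schwarz, Bessel and the
  -- summability of ‖T b_i‖².
  have hlim : Tendsto G atTop (𝓝 T) := by
    rw [Metric.tendsto_atTop]
    intro η hη
    obtain ⟨s, hs'⟩ := summable_iff_vanishing_norm.1 hs ((η / 2) ^ 2) (by positivity)
    refine ⟨s, fun s₁ hs₁ => ?_⟩
    rw [dist_comm, dist_eq_norm]
    refine lt_of_le_of_lt (ContinuousLinearMap.opNorm_le_bound _ (by positivity) fun f => ?_)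
      (half_lt_self hη)
    have hsum : HasSum (fun i => ⟪b i, f⟫_ℂ • T (b i)) (T f) := by
      have := (b.hasSum_repr f).mapL T
      simpa [b.repr_apply_apply] using this
    rw [sub_apply, hG]
    refine le_of_tendsto ((hsum.sub_const _).norm : Tendsto _ atTop _) ?_
    filter_upwards [eventually_ge_atTop s₁] with s₂ hs₂
    rw [← Finset.sum_sdiff hs₂, add_sub_cancel_right]
    calc ‖∑ i ∈ s₂ \ s₁, ⟪b i, f⟫_ℂ • T (b i)‖
        ≤ ∑ i ∈ s₂ \ s₁, ‖⟪b i, f⟫_ℂ‖ * ‖T (b i)‖ :=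
          (norm_sum_le _ _).trans (Finset.sum_le_sum fun i _ => (norm_smul_le _ _))
      _ ≤ √(∑ i ∈ s₂ \ s₁, ‖⟪b i, f⟫_ℂ‖ ^ 2) * √(∑ i ∈ s₂ \ s₁, ‖T (b i)‖ ^ 2) :=
          Real.sum_mul_le_sqrt_mul_sqrt _ _ _
      _ ≤ ‖f‖ * (η / 2) := by
          gcongr
          · exact Real.sqrt_le_iff.2 ⟨norm_nonneg _, b.orthonormal.sum_inner_products_le f⟩
          · refine Real.sqrt_le_iff.2 ⟨by positivity, ?_⟩
            have := hs' (s₂ \ s₁) (Finset.disjoint_of_subset_right hs₁ Finset.sdiff_disjoint)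
            exact (le_abs_self _).trans this.le
      _ = η / 2 * ‖f‖ := mul_comm _ _
  exact isCompactOperator_of_tendsto hlim (Eventually.of_forall hGc)

/-- A compact self-adjoint operator has a Hilbert basis of eigenvectors. -/
theorem exists_hilbertBasis_eigenvectors {S : E →L[ℂ] E} (hS : IsCompactOperator S)
    (hsym : (S : E →ₗ[ℂ] E).IsSymmetric) :
    ∃ (ι : Type u) (b : HilbertBasis ι ℂ E) (c : ι → ℂ), ∀ i, S (b i) = c i • b i := by
  have hcomplete : ∀ z : ℂ, CompleteSpace (Module.End.eigenspace (S : E →ₗ[ℂ] E) z) := fun z => by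
    have : IsClosed (Module.End.eigenspace (S : E →ₗ[ℂ] E) z : Set E) := by
      have h : (Module.End.eigenspace (S : E →ₗ[ℂ] E) z : Set E) = {f | S f = z • f} := by
        ext f; simp
      rw [h]
      exact isClosed_eq S.continuous (continuous_const_smul z)
    exact this.completeSpace_coe
  choose w b hb using fun z : ℂ =>
    exists_hilbertBasis ℂ (Module.End.eigenspace (S : E →ₗ[ℂ] E) z)
  have hon := hsym.orthogonalFamily_eigenspaces.orthonormal_sigma_orthonormal
    (fun z => (b z).orthonormal)
  refine ⟨Σ z, w z, HilbertBasis.mkOfOrthogonalEqBot hon ?_, fun i => i.1, fun i => ?_⟩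
  · rw [← ContinuousLinearMap.orthogonalComplement_iSup_eigenspaces_eq_bot hS hsym]
    refine le_antisymm ?_ (Submodule.orthogonal_le ?_)
    · intro f hf
      rw [← Submodule.iInf_orthogonal, Submodule.mem_iInf]
      intro z
      rw [Submodule.mem_orthogonal]
      intro u hu
      have hden := (b z).dense_span
      have h1 : ∀ v : Module.End.eigenspace (S : E →ₗ[ℂ] E) z, ⟪(v : E), f⟫_ℂ = 0 := by
        intro v
        have hv : v ∈ (Submodule.span ℂ (Set.range (b z))).topologicalClosure := by
          rw [hden]; trivial
        have hcl : IsClosed {v : Module.End.eigenspace (S : E →ₗ[ℂ] E) z | ⟪(v : E), f⟫_ℂ = 0} :=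
          isClosed_eq (by fun_prop) continuous_const
        refine closure_minimal ?_ hcl hv
        intro v hv
        induction hv using Submodule.span_induction with
        | mem v hv =>
          obtain ⟨i, rfl⟩ := hv
          exact (Submodule.mem_orthogonal _ _).1 hf _ (Submodule.subset_span ⟨⟨z, i⟩, rfl⟩)
        | zero => simp
        | add x y _ _ hx hy =>
          simp only [Set.mem_ofPred_eq] at hx hy
          simp [hx, hy]
        | smul c x _ hx =>
          simp only [Set.mem_ofPred_eq] at hx
          simp [hx]
      exact h1 ⟨u, hu⟩
    · rw [Submodule.span_le]
      rintro _ ⟨⟨z, i⟩, rfl⟩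
      exact Submodule.mem_iSup_of_mem z (b z i).2
  · rw [HilbertBasis.coe_mkOfOrthogonalEqBot]
    exact Module.End.mem_eigenspace_iff.1 (b i.1 i.2).2

/-- A decreasing orthonormal sequence of eigenvectors of `T* T`, continued by `0`, determines the
singular values of `T`. -/
theorem singularValue_eq {T : E →L[ℂ] F} {e : ℕ → E} {s : ℕ → ℝ}
    (hone : ∀ k, e k ≠ 0 → ‖e k‖ = 1) (horth : ∀ i j, i ≠ j → ⟪e i, e j⟫_ℂ = 0)
    (hsum : ∀ f, HasSum (fun k => ⟪e k, f⟫_ℂ • e k) f)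
    (hT : ∀ k, T.adjoint (T (e k)) = ((s k ^ 2 : ℝ) : ℂ) • e k) (hanti : Antitone s)
    (hpos : ∀ k, e k ≠ 0 → 0 < s k) (hzero : ∀ k, e k = 0 → s k = 0) (k : ℕ) :
    singularValue T k = s k := by
  have hs0 : ∀ k, 0 ≤ s k := fun k => by
    by_cases h : e k = 0
    · exact (hzero k h).ge
    · exact (hpos k h).le
  have hub : ∀ r ∈ {r : ℝ | 0 < r ∧ ∃ v : Fin (k + 1) → E, Orthonormal ℂ v ∧
      ∀ i, ∃ t : ℝ, r ≤ t ∧ T.adjoint (T (v i)) = ((t ^ 2 : ℝ) : ℂ) • v i}, r ≤ s k := by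
    rintro r ⟨hr, v, hv, hvt⟩
    by_contra! hlt
    -- Eigenvectors with eigenvalue above s_k² are orthogonal to every `e j` with j ≥ k; hence k + 1
    -- independent vectors would lie in the span of k.
    have hmem : ∀ i, v i ∈ Submodule.span ℂ (Set.range fun j : Fin k => e j) := by
      intro i
      obtain ⟨t, hrt, ht⟩ := hvt i
      have hz : ∀ j, k ≤ j → ⟪e j, v i⟫_ℂ = 0 := fun j hj => by
        have h1 : ⟪T.adjoint (T (e j)), v i⟫_ℂ = ⟪e j, T.adjoint (T (v i))⟫_ℂ := by
          rw [ContinuousLinearMap.adjoint_inner_left, ContinuousLinearMap.adjoint_inner_right]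
        rw [hT, ht, inner_smul_left, inner_smul_right, Complex.conj_ofReal, ← sub_eq_zero,
          ← sub_mul] at h1
        refine (mul_eq_zero.1 h1).resolve_left ?_
        rw [← Complex.ofReal_sub]
        have : s j ^ 2 < t ^ 2 := by
          have := hanti hj
          have := hs0 j
          gcongr
          linarith
        exact_mod_cast (sub_neg.2 this).ne
      have h2 : v i = ∑ j ∈ Finset.range k, ⟪e j, v i⟫_ℂ • e j :=
        (hsum (v i)).unique (hasSum_sum_of_ne_finset_zero fun j hj => by
          rw [hz j (by simpa using hj), zero_smul])
      rw [h2]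
      refine Submodule.sum_mem _ fun j hj => Submodule.smul_mem _ _ (Submodule.subset_span ?_)
      exact ⟨⟨j, Finset.mem_range.1 hj⟩, rfl⟩
    have h3 := hv.linearIndependent
    have h4 : LinearIndependent ℂ
        (fun i => (⟨v i, hmem i⟩ : Submodule.span ℂ (Set.range fun j : Fin k => e j))) :=
      LinearIndependent.of_comp (Submodule.subtype _) h3
    have : FiniteDimensional ℂ (Submodule.span ℂ (Set.range fun j : Fin k => e j)) :=
      FiniteDimensional.span_of_finite ℂ (Set.finite_range _)
    have h5 := h4.fintype_card_le_finrank
    have h6 := finrank_range_le_card (R := ℂ) (fun j : Fin k => e j)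
    rw [Fintype.card_fin] at h5 h6
    unfold Set.finrank at h6
    omega
  unfold singularValue
  by_cases hk : e k = 0
  · rw [hzero k hk] at hub ⊢
    -- The defining set contains only positive numbers, so the bound 0 makes it empty.
    convert! Real.sSup_empty
    refine Set.eq_empty_of_forall_notMem fun r hr => ?_
    exact absurd (hub r hr) (not_le.2 hr.1)
  · refine IsGreatest.csSup_eq ⟨⟨hpos k hk, fun i => e i, ⟨fun i => ?_, fun i j hij => ?_⟩,
      fun i => ⟨s i, hanti (Nat.lt_succ_iff.1 i.2), hT i⟩⟩, hub⟩
    · refine hone _ fun h => ?_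
      have h1 := hanti (Nat.lt_succ_iff.1 i.2)
      rw [hzero _ h] at h1
      exact absurd (hpos k hk) (not_lt.2 h1)
    · exact horth _ _ fun h => hij (Fin.ext h)

/-- `e` is a complete orthonormal sequence of right singular vectors of `T`, listed by decreasing
singular value and continued by `0` if there are only finitely many. -/
structure IsSingularSequence (T : E →L[ℂ] F) (e : ℕ → E) : Prop where
  norm_eq_one : ∀ k, e k ≠ 0 → ‖e k‖ = 1
  inner_eq_zero : ∀ i j, i ≠ j → ⟪e i, e j⟫_ℂ = 0
  hasSum : ∀ f, HasSum (fun k => ⟪e k, f⟫_ℂ • e k) f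
  inner_map : ∀ i j,
    ⟪T (e i), T (e j)⟫_ℂ = if i = j then ((singularValue T i ^ 2 : ℝ) : ℂ) else 0
  antitone : Antitone (singularValue T)
  pos : ∀ k, e k ≠ 0 → 0 < singularValue T k
  eq_zero : ∀ k, e k = 0 → singularValue T k = 0
  summable : Summable fun k => singularValue T k ^ 2

/-- The singular value decomposition of an injective Hilbert-Schmidt operator. -/
theorem exists_singular_sequence (T : E →L[ℂ] F) (hinj : ∀ f, f ≠ 0 → T f ≠ 0)
    (hHS : ∀ {ι : Type u} (b : HilbertBasis ι ℂ E), Summable fun i => ‖T (b i)‖ ^ 2) :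
    ∃ e : ℕ → E, IsSingularSequence T e := by
  obtain ⟨w, b₀, -⟩ := exists_hilbertBasis ℂ E
  have hTc := isCompactOperator_of_summable b₀ T (hHS b₀)
  have hSc : IsCompactOperator (T.adjoint ∘L T) := hTc.clm_comp T.adjoint
  have hsym : ((T.adjoint ∘L T : E →L[ℂ] E) : E →ₗ[ℂ] E).IsSymmetric := fun x y => by
    simp [ContinuousLinearMap.adjoint_inner_left, ContinuousLinearMap.adjoint_inner_right]
  obtain ⟨ι, b, c, hbc⟩ := exists_hilbertBasis_eigenvectors hSc hsym
  have hs := hHS b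
  have hb0 : ∀ i, b i ≠ 0 := fun i => b.orthonormal.ne_zero i
  have hpos : ∀ i, 0 < ‖T (b i)‖ ^ 2 := fun i => by
    have := norm_pos_iff.2 (hinj _ (hb0 i))
    positivity
  have heig : ∀ i, T.adjoint (T (b i)) = ((‖T (b i)‖ ^ 2 : ℝ) : ℂ) • b i := fun i => by
    have h1 : T.adjoint (T (b i)) = c i • b i := hbc i
    have h2 : ⟪b i, T.adjoint (T (b i))⟫_ℂ = c i := by
      rw [h1, inner_smul_right, inner_self_eq_norm_sq_to_K, b.orthonormal.1 i]
      simp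
    rw [ContinuousLinearMap.adjoint_inner_right, inner_self_eq_norm_sq_to_K] at h2
    rw [h1, ← h2]
    simp
  obtain ⟨r, hr, hrmono, hrinit⟩ := exists_decreasing_rank hpos hs
  set e : ℕ → E := Function.extend r b 0 with he
  set s : ℕ → ℝ := Function.extend r (fun i => ‖T (b i)‖) 0 with hsdef
  have her : ∀ i, e (r i) = b i := fun i => hr.extend_apply _ _ i
  have hsr : ∀ i, s (r i) = ‖T (b i)‖ := fun i => hr.extend_apply _ _ i
  have hen : ∀ k, (¬ ∃ i, r i = k) → e k = 0 := fun k hk => Function.extend_apply' _ _ _ hk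
  have hsn : ∀ k, (¬ ∃ i, r i = k) → s k = 0 := fun k hk => Function.extend_apply' _ _ _ hk
  have hone : ∀ k, e k ≠ 0 → ‖e k‖ = 1 := fun k hk => by
    by_cases h : ∃ i, r i = k
    · obtain ⟨i, rfl⟩ := h
      rw [her, b.orthonormal.1 i]
    · exact absurd (hen k h) hk
  have horth : ∀ i j, i ≠ j → ⟪e i, e j⟫_ℂ = 0 := fun i j hij => by
    by_cases hi : ∃ i', r i' = i
    · by_cases hj : ∃ j', r j' = j
      · obtain ⟨i, rfl⟩ := hi
        obtain ⟨j, rfl⟩ := hj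
        rw [her, her, b.orthonormal.2 fun h => hij (congrArg r h)]
      · rw [hen j hj, inner_zero_right]
    · rw [hen i hi, inner_zero_left]
  have hsum : ∀ f, HasSum (fun k => ⟪e k, f⟫_ℂ • e k) f := fun f => by
    rw [← hr.hasSum_iff fun k hk => by rw [hen k hk, smul_zero]]
    have := b.hasSum_repr f
    simpa [Function.comp_def, her, b.repr_apply_apply] using this
  have hT : ∀ k, T.adjoint (T (e k)) = ((s k ^ 2 : ℝ) : ℂ) • e k := fun k => by
    by_cases h : ∃ i, r i = k
    · obtain ⟨i, rfl⟩ := h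
      rw [her, hsr, heig]
    · rw [hen k h]; simp
  have hanti : Antitone s := fun k l hkl => by
    by_cases h : ∃ j, r j = l
    · obtain ⟨j, rfl⟩ := h
      rcases hkl.eq_or_lt with rfl | hlt
      · rfl
      · obtain ⟨i, rfl⟩ := hrinit j k hlt
        rw [hsr, hsr]
        exact (sq_le_sq₀ (norm_nonneg _) (norm_nonneg _)).1 (hrmono i j hlt)
    · rw [hsn l h]
      by_cases h' : ∃ i, r i = k
      · obtain ⟨i, rfl⟩ := h'
        rw [hsr]; exact norm_nonneg _
      · rw [hsn k h']
  have hspos : ∀ k, e k ≠ 0 → 0 < s k := fun k hk => by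
    by_cases h : ∃ i, r i = k
    · obtain ⟨i, rfl⟩ := h
      rw [hsr]; exact norm_pos_iff.2 (hinj _ (hb0 i))
    · exact absurd (hen k h) hk
  have hszero : ∀ k, e k = 0 → s k = 0 := fun k hk => by
    by_cases h : ∃ i, r i = k
    · obtain ⟨i, rfl⟩ := h
      rw [her] at hk
      exact absurd hk (hb0 i)
    · exact hsn k h
  have hsv : singularValue T = s :=
    funext fun k => singularValue_eq hone horth hsum hT hanti hspos hszero k
  refine ⟨e, hone, horth, hsum, ?_, ?_, ?_, ?_, ?_⟩ <;> rw [hsv]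
  · intro i j
    rw [← ContinuousLinearMap.adjoint_inner_right, hT, inner_smul_right]
    split_ifs with h
    · subst h
      by_cases h0 : e i = 0
      · rw [h0, hszero i h0]; simp
      · rw [inner_self_eq_norm_sq_to_K, hone i h0]; simp
    · rw [horth i j h, mul_zero]
  · exact hanti
  · exact hspos
  · exact hszero
  · rw [← hr.summable_iff fun k hk => by rw [hsn k hk]; simp]
    simpa [Function.comp_def, hsr] using hs

end SingularSequence

/-! ### Parseval identities and the abstract least squares map. -/

section Decomposition

open Filter Topology

variable {E F : Type*} [NormedAddCommGroup E] [InnerProductSpace ℂ E] [CompleteSpace E]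
  [NormedAddCommGroup F] [InnerProductSpace ℂ F] [CompleteSpace F] {T : E →L[ℂ] F} {e : ℕ → E}

theorem IsSingularSequence.hasSum_norm_inner_sq (h : IsSingularSequence T e) (f : E) :
    HasSum (fun k => ‖⟪e k, f⟫_ℂ‖ ^ 2) (‖f‖ ^ 2) := by
  have h1 := ((h.hasSum f).mapL (innerSL ℂ f)).mapL Complex.reCLM
  convert! h1 using 1
  · ext k
    simp only [innerSL_apply_apply, inner_smul_right, Complex.reCLM_apply]
    rw [← inner_conj_symm f (e k), RCLike.mul_conj]
    norm_cast
  · simp only [innerSL_apply_apply, Complex.reCLM_apply]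
    rw [inner_self_eq_norm_sq_to_K]
    norm_cast

theorem IsSingularSequence.sum_norm_inner_sq_le (h : IsSingularSequence T e) (f : E)
    (s : Finset ℕ) : ∑ k ∈ s, ‖⟪e k, f⟫_ℂ‖ ^ 2 ≤ ‖f‖ ^ 2 :=
  sum_le_hasSum s (fun _ _ => by positivity) (h.hasSum_norm_inner_sq f)

theorem IsSingularSequence.norm_sq_map_sum (h : IsSingularSequence T e) (s : Finset ℕ)
    (a : ℕ → ℂ) :
    ‖T (∑ k ∈ s, a k • e k)‖ ^ 2 = ∑ k ∈ s, singularValue T k ^ 2 * ‖a k‖ ^ 2 := by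
  have h1 : ⟪T (∑ k ∈ s, a k • e k), T (∑ k ∈ s, a k • e k)⟫_ℂ =
      ((∑ k ∈ s, singularValue T k ^ 2 * ‖a k‖ ^ 2 : ℝ) : ℂ) := by
    simp only [map_sum, map_smul, sum_inner, inner_sum, inner_smul_left, inner_smul_right,
      h.inner_map]
    push_cast
    refine Finset.sum_congr rfl fun k hk => ?_
    simp only [mul_ite, mul_zero, Finset.sum_ite_eq', hk, if_true]
    rw [← Complex.mul_conj']
    ring
  rw [inner_self_eq_norm_sq_to_K] at h1
  exact Complex.ofReal_injective (by rw [← h1]; simp)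

theorem IsSingularSequence.inner_map_sum_eq_zero (h : IsSingularSequence T e) {s t : Finset ℕ}
    (hst : Disjoint s t) (a b : ℕ → ℂ) :
    ⟪T (∑ k ∈ s, a k • e k), T (∑ k ∈ t, b k • e k)⟫_ℂ = 0 := by
  simp only [map_sum, map_smul, sum_inner, inner_sum, inner_smul_left, inner_smul_right,
    h.inner_map]
  refine Finset.sum_eq_zero fun j hj => mul_eq_zero_of_right _ (Finset.sum_eq_zero fun i hi => ?_)
  rw [if_neg fun hij : i = j => Finset.disjoint_left.1 hst hi (hij ▸ hj), mul_zero]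

/-- A linear map between finite-dimensional inner product spaces that is bounded below has a left
inverse with the reciprocal bound. -/
theorem exists_leftInverse_of_bounded_below {V W : Type*} [NormedAddCommGroup V]
    [InnerProductSpace ℂ V] [FiniteDimensional ℂ V] [NormedAddCommGroup W] [InnerProductSpace ℂ W]
    [FiniteDimensional ℂ W] (A : V →ₗ[ℂ] W) {c : ℝ} (hc : 0 < c)
    (h : ∀ v, c * ‖v‖ ^ 2 ≤ ‖A v‖ ^ 2) :
    ∃ L : W →ₗ[ℂ] V, (∀ v, L (A v) = v) ∧ ∀ w, c * ‖L w‖ ^ 2 ≤ ‖w‖ ^ 2 := by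
  have hinj : Function.Injective A := by
    rw [injective_iff_map_eq_zero]
    intro v hv
    have := h v
    rw [hv, norm_zero] at this
    have h2 : ‖v‖ ^ 2 ≤ 0 := by nlinarith
    exact norm_eq_zero.1 (pow_eq_zero_iff two_ne_zero |>.1 (le_antisymm h2 (by positivity)))
  let eqv := LinearEquiv.ofInjective A hinj
  -- Least squares: project orthogonally onto the range, then invert. The projection costs nothing
  -- in norm.
  let L : W →ₗ[ℂ] V :=
    eqv.symm.toLinearMap ∘ₗ (LinearMap.range A).orthogonalProjectionOnto.toLinearMap
  have hAL : ∀ w, A (L w) = (LinearMap.range A).orthogonalProjectionOnto w := fun w => by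
    have := congrArg Subtype.val
      (eqv.apply_symm_apply ((LinearMap.range A).orthogonalProjectionOnto w))
    exact this
  refine ⟨L, fun v => hinj ?_, fun w => (h (L w)).trans ?_⟩
  · rw [hAL]
    exact Submodule.orthogonalProjectionOnto_mem_subspace_eq_self
      (⟨A v, LinearMap.mem_range_self A v⟩ : LinearMap.range A) |> congrArg Subtype.val
  · rw [hAL]
    have := (LinearMap.range A).norm_orthogonalProjectionOnto_apply_le w
    gcongr
    exact this

end Decomposition

/-! ### The embedding into L_2 and the diagonal of the kernel. -/

section Kernel

variable {D : Type*} [MeasurableSpace D] {μ : Measure D} {H : Type*} [NormedAddCommGroup H]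
  [InnerProductSpace ℂ H] [RKHS ℂ H D ℂ]

theorem EmbedsInL2.embedding_apply (hH : EmbedsInL2 H μ) (f : H) :
    hH.embedding f = (hH.memLp f).toLp f := rfl

theorem EmbedsInL2.eLpNorm_eq (hH : EmbedsInL2 H μ) (f : H) :
    eLpNorm f 2 μ = ENNReal.ofReal ‖hH.embedding f‖ := by
  rw [hH.embedding_apply, Lp.norm_toLp, ENNReal.ofReal_toReal (hH.memLp f).eLpNorm_ne_top]

theorem EmbedsInL2.embedding_ne_zero (hH : EmbedsInL2 H μ) {f : H} (hf : f ≠ 0) :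
    hH.embedding f ≠ 0 := fun h => hH.injective f hf (by rw [hH.eLpNorm_eq, h]; simp)

theorem EmbedsInL2.inner_embedding (hH : EmbedsInL2 H μ) (f g : H) :
    Integrable (fun x => star (f x) * g x) μ ∧
      ∫ x, star (f x) * g x ∂μ = ⟪hH.embedding f, hH.embedding g⟫_ℂ := by
  have hae : (fun x => ⟪hH.embedding f x, hH.embedding g x⟫_ℂ) =ᵐ[μ]
      fun x => star (f x) * g x := by
    filter_upwards [(hH.memLp f).coeFn_toLp, (hH.memLp g).coeFn_toLp] with x h1 h2
    rw [hH.embedding_apply, hH.embedding_apply, h1, h2]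
    simp [mul_comm]
  refine ⟨(L2.integrable_inner (𝕜 := ℂ) (hH.embedding f) (hH.embedding g)).congr hae, ?_⟩
  rw [L2.inner_def]
  exact (integral_congr_ae hae).symm

theorem EmbedsInL2.norm_sq_embedding (hH : EmbedsInL2 H μ) (f : H) :
    Integrable (fun x => ‖f x‖ ^ 2) μ ∧ ∫ x, ‖f x‖ ^ 2 ∂μ = ‖hH.embedding f‖ ^ 2 := by
  obtain ⟨h1, h2⟩ := hH.inner_embedding f f
  have h3 : ∀ x, star (f x) * f x = ((‖f x‖ ^ 2 : ℝ) : ℂ) := fun x => by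
    rw [Complex.star_def, ← Complex.normSq_eq_conj_mul_self, Complex.normSq_eq_norm_sq]
  simp only [h3] at h1 h2
  refine ⟨h1.re, ?_⟩
  rw [integral_complex_ofReal, inner_self_eq_norm_sq_to_K] at h2
  exact Complex.ofReal_injective (by rw [h2]; simp)

variable [CompleteSpace H]

omit [MeasurableSpace D] in
theorem RKHS.kernel_self_re (x : D) : (RKHS.kernel H x x 1).re = ‖RKHS.kerFun H x 1‖ ^ 2 := by
  have h := RKHS.kernel_inner H x x (1 : ℂ) (1 : ℂ)
  rw [inner_self_eq_norm_sq_to_K] at h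
  have h2 := congrArg Complex.re h
  simp only [RCLike.inner_apply, one_mul] at h2
  rw [Complex.conj_re] at h2
  rw [h2]
  norm_cast

omit [MeasurableSpace D] in
theorem RKHS.inner_kerFun_one (x : D) (f : H) : ⟪f, RKHS.kerFun H x 1⟫_ℂ = star (f x) := by
  rw [RKHS.inner_kerFun]; simp

/-- Bessel's inequality for the kernel function at x gives ∑ |b_i(x)|² ≤ K(x, x); integrate over D.
-/
theorem EmbedsInL2.summable_norm_sq (hH : EmbedsInL2 H μ) (hK : kernelTrace H μ < ∞)
    {ι : Type*} (b : HilbertBasis ι ℂ H) : Summable fun i => ‖hH.embedding (b i)‖ ^ 2 := by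
  refine summable_of_sum_le (c := (kernelTrace H μ).toReal) (fun i => by positivity) fun s => ?_
  have h1 : ∑ i ∈ s, ‖hH.embedding (b i)‖ ^ 2 = ∫ x, ∑ i ∈ s, ‖b i x‖ ^ 2 ∂μ := by
    rw [integral_finsetSum _ fun i _ => (hH.norm_sq_embedding (b i)).1]
    exact Finset.sum_congr rfl fun i _ => (hH.norm_sq_embedding (b i)).2.symm
  rw [h1, integral_eq_lintegral_of_nonneg_ae
    (Filter.Eventually.of_forall fun x => Finset.sum_nonneg fun i _ => by positivity)
    (integrable_finsetSum _ fun i _ => (hH.norm_sq_embedding (b i)).1).aestronglyMeasurable]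
  refine ENNReal.toReal_mono hK.ne (lintegral_mono fun x => ENNReal.ofReal_le_ofReal ?_)
  rw [RKHS.kernel_self_re]
  have := b.orthonormal.sum_inner_products_le (RKHS.kerFun H x 1) (s := s)
  simpa [RKHS.inner_kerFun_one] using this

variable {hH : EmbedsInL2 H μ} {e : ℕ → H}

theorem IsSingularSequence.summable_norm_apply_sq (h : IsSingularSequence hH.embedding e) (x : D) :
    Summable fun k => ‖e k x‖ ^ 2 := by
  have := (h.hasSum_norm_inner_sq (RKHS.kerFun H x 1)).summable
  simpa [RKHS.inner_kerFun_one] using this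

/-- The trace of the kernel of the orthogonal complement of the first `N` singular vectors. -/
theorem IsSingularSequence.integral_tsum_norm_sq (h : IsSingularSequence hH.embedding e) (N : ℕ) :
    Integrable (fun x => ∑' k, ‖e (k + N) x‖ ^ 2) μ ∧
      ∫ x, ∑' k, ‖e (k + N) x‖ ^ 2 ∂μ = ∑' k, singularValue hH.embedding (k + N) ^ 2 := by
  have hint : ∀ k, ∫ x, ‖e k x‖ ^ 2 ∂μ = singularValue hH.embedding k ^ 2 := fun k => by
    rw [(hH.norm_sq_embedding (e k)).2]
    have := h.norm_sq_map_sum {k} 1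
    simpa using this
  have hs : Summable fun k => ∫ x, ‖‖e (k + N) x‖ ^ 2‖ ∂μ := by
    simp only [norm_pow, norm_norm, hint]
    exact (summable_nat_add_iff N).2 h.summable
  have hi := fun k => (hH.norm_sq_embedding (e (k + N))).1
  have h1 := hasSum_integral_of_summable_integral_norm hi hs
  simp only [hint] at h1
  refine ⟨?_, h1.tsum_eq.symm⟩
  have hpt : ∀ x, ∑' k, ‖e (k + N) x‖ ^ 2 =
      (∑' k, ENNReal.ofReal (‖e (k + N) x‖ ^ 2)).toReal := fun x => by
    rw [← ENNReal.ofReal_tsum_of_nonneg (fun _ => by positivity)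
      ((summable_nat_add_iff N).2 (h.summable_norm_apply_sq x)),
      ENNReal.toReal_ofReal (tsum_nonneg fun _ => by positivity)]
  have hm : ∀ k, AEMeasurable (fun x => ENNReal.ofReal (‖e (k + N) x‖ ^ 2)) μ := fun k =>
    (hi k).aestronglyMeasurable.aemeasurable.ennreal_ofReal
  simp only [hpt]
  refine integrable_toReal_of_lintegral_ne_top (AEMeasurable.tsum hm) ?_
  rw [lintegral_tsum hm]
  have : ∀ k, ∫⁻ x, ENNReal.ofReal (‖e (k + N) x‖ ^ 2) ∂μ =
      ENNReal.ofReal (singularValue hH.embedding (k + N) ^ 2) := fun k => by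
    rw [← hint, ofReal_integral_eq_lintegral_ofReal (hi k)
      (Filter.Eventually.of_forall fun x => by positivity)]
  simp only [this]
  rw [← ENNReal.ofReal_tsum_of_nonneg (fun _ => by positivity)
      ((summable_nat_add_iff N).2 h.summable)]
  exact ENNReal.ofReal_ne_top

/-- Continuity of evaluation allows the expansion of f to be evaluated termwise; Cauchy-Schwarz and
Bessel then give the bound. -/
theorem IsSingularSequence.norm_apply_sub_sum_sq_le (h : IsSingularSequence hH.embedding e)
    (f : H) (N : ℕ) (x : D) :
    ‖(f - ∑ k ∈ Finset.range N, ⟪e k, f⟫_ℂ • e k) x‖ ^ 2 ≤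
      ‖f‖ ^ 2 * ∑' k, ‖e (k + N) x‖ ^ 2 := by
  have h1 := h.hasSum f
  have h2 := (hasSum_nat_add_iff' N).2 h1
  have h3 : HasSum (fun k => ⟪e (k + N), f⟫_ℂ * e (k + N) x)
      ((f - ∑ k ∈ Finset.range N, ⟪e k, f⟫_ℂ • e k) x) := by
    have := h2.mapL ((ContinuousLinearMap.proj x).comp (RKHS.coeCLM ℂ : H →L[ℂ] D → ℂ))
    simpa using this
  have hs := (summable_nat_add_iff N).2 (h.summable_norm_apply_sq x)
  have h4 : ‖(f - ∑ k ∈ Finset.range N, ⟪e k, f⟫_ℂ • e k) x‖ ≤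
      ‖f‖ * √(∑' k, ‖e (k + N) x‖ ^ 2) := by
    refine le_of_tendsto (h3.norm : Filter.Tendsto _ Filter.atTop _)
      (Filter.Eventually.of_forall fun s => ?_)
    calc ‖∑ k ∈ s, ⟪e (k + N), f⟫_ℂ * e (k + N) x‖
        ≤ ∑ k ∈ s, ‖⟪e (k + N), f⟫_ℂ‖ * ‖e (k + N) x‖ :=
          (norm_sum_le _ _).trans (Finset.sum_le_sum fun i _ => (norm_mul_le _ _))
      _ ≤ √(∑ k ∈ s, ‖⟪e (k + N), f⟫_ℂ‖ ^ 2) * √(∑ k ∈ s, ‖e (k + N) x‖ ^ 2) :=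
          Real.sum_mul_le_sqrt_mul_sqrt _ _ _
      _ ≤ ‖f‖ * √(∑' k, ‖e (k + N) x‖ ^ 2) := by
          gcongr
          · refine Real.sqrt_le_iff.2 ⟨norm_nonneg _, ?_⟩
            have := h.sum_norm_inner_sq_le f (s.map (addRightEmbedding N))
            simpa using this
          · exact hs.sum_le_tsum s fun _ _ => by positivity
  calc _ ≤ (‖f‖ * √(∑' k, ‖e (k + N) x‖ ^ 2)) ^ 2 := by gcongr
    _ = _ := by rw [mul_pow, Real.sq_sqrt (tsum_nonneg fun _ => by positivity)]

end Kernel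

/-! ### Weighted least squares and its error. -/

section Sampling

variable {E F : Type*} [NormedAddCommGroup E] [InnerProductSpace ℂ E] [CompleteSpace E]
  [NormedAddCommGroup F] [InnerProductSpace ℂ F] [CompleteSpace F]

/-- The linear combination of singular vectors with coefficients `v k / σ_k`; it maps to the
combination of left singular vectors with coefficients `v k`. -/
noncomputable def singularCombination (T : E →L[ℂ] F) (e : ℕ → E) (s : Finset ℕ) : (s → ℂ) →ₗ[ℂ] E where
  toFun v := ∑ k : s, (v k / singularValue T k) • e k
  map_add' v w := by simp [add_div, add_smul, Finset.sum_add_distrib]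
  map_smul' c v := by simp [Finset.smul_sum, smul_smul, mul_div_assoc]

variable {T : E →L[ℂ] F} {e : ℕ → E}

theorem singularCombination_eq (s : Finset ℕ) (v : s → ℂ) :
    ∃ a : ℕ → ℂ, (∀ k : s, a k = v k / singularValue T k) ∧
      singularCombination T e s v = ∑ k ∈ s, a k • e k := by
  refine ⟨fun k => if h : k ∈ s then v ⟨k, h⟩ / singularValue T k else 0, fun k => by simp, ?_⟩
  rw [← Finset.sum_coe_sort s]
  simp [singularCombination]

theorem IsSingularSequence.norm_sq_map_singularCombination (h : IsSingularSequence T e)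
    {s : Finset ℕ} (hs : ∀ k ∈ s, e k ≠ 0) (v : s → ℂ) :
    ‖T (singularCombination T e s v)‖ ^ 2 = ∑ k, ‖v k‖ ^ 2 := by
  obtain ⟨a, ha, hv⟩ := singularCombination_eq (T := T) (e := e) s v
  rw [hv, h.norm_sq_map_sum, ← Finset.sum_coe_sort s]
  refine Finset.sum_congr rfl fun k _ => ?_
  have hσ := h.pos k (hs k k.2)
  rw [ha, norm_div, Complex.norm_real, Real.norm_of_nonneg hσ.le]
  field_simp

theorem IsSingularSequence.inner_map_singularCombination (h : IsSingularSequence T e)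
    {s t : Finset ℕ} (hst : Disjoint s t) (v : s → ℂ) (w : t → ℂ) :
    ⟪T (singularCombination T e s v), T (singularCombination T e t w)⟫_ℂ = 0 := by
  obtain ⟨a, -, ha⟩ := singularCombination_eq (T := T) (e := e) s v
  obtain ⟨b, -, hb⟩ := singularCombination_eq (T := T) (e := e) t w
  rw [ha, hb, h.inner_map_sum_eq_zero hst]

-- The filter removes the vectors that only continue the sequence by 0, where dividing by the
-- singular value is impossible.
open Classical in
theorem IsSingularSequence.singularCombination_coeff (h : IsSingularSequence T e) (s : Finset ℕ)
    (f : E) :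
    singularCombination T e (s.filter fun k => e k ≠ 0) (fun k => singularValue T k * ⟪e k, f⟫_ℂ) =
      ∑ k ∈ s, ⟪e k, f⟫_ℂ • e k := by
  rw [← Finset.sum_filter_of_ne (p := fun k => e k ≠ 0) (fun k _ hk h0 => hk (by rw [h0, smul_zero])),
    ← Finset.sum_coe_sort (s.filter fun k => e k ≠ 0)]
  refine Finset.sum_congr rfl fun k _ => ?_
  have hσ := h.pos k (Finset.mem_filter.1 k.2).2
  have : (singularValue T k : ℂ) ≠ 0 := by exact_mod_cast hσ.ne'
  rw [mul_div_cancel_left₀ _ this]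

variable {D : Type*} [MeasurableSpace D] {μ : Measure D} {H : Type*} [NormedAddCommGroup H]
  [InnerProductSpace ℂ H] [RKHS ℂ H D ℂ]

omit [MeasurableSpace D] in
theorem RKHS.coe_finsetSum {ι : Type*} (s : Finset ι) (f : ι → H) :
    ⇑(∑ i ∈ s, f i) = ∑ i ∈ s, ⇑(f i) :=
  map_sum (RKHS.coeCLM ℂ : H →L[ℂ] D → ℂ) f s

/-- A linear sampling method, given as a linear map on the space, bounds the sampling number. -/
theorem EmbedsInL2.linSamplingNumber_le (hH : EmbedsInL2 H μ) {n : ℕ} (x : Fin n → D)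
    (ψ : Fin n → H) {r : ℝ}
    (h : ∀ f : H, ‖f‖ ≤ 1 → ‖hH.embedding (f - ∑ i, f (x i) • ψ i)‖ ≤ r) :
    linSamplingNumber μ (unitBallFunctions H) n ≤ ENNReal.ofReal r := by
  refine iInf₂_le_of_le x (fun i => ψ i) (iInf_le_of_le (fun i => hH.memLp (ψ i)) ?_)
  refine iSup₂_le fun g hg => ?_
  obtain ⟨f, hf, rfl⟩ := hg
  have : (fun t => f t - ∑ i, f (x i) * ψ i t) = ⇑(f - ∑ i, f (x i) • ψ i) := by
    ext t
    rw [RKHS.coe_sub, RKHS.coe_finsetSum]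
    simp
  simp only [this]
  rw [hH.eLpNorm_eq]
  exact ENNReal.ofReal_le_ofReal (h f (by simpa using hf))

variable [CompleteSpace H] {hH : EmbedsInL2 H μ} {e : ℕ → H}

/-- The conjugates make `star (b x) ⬝ᵥ v` the value at x of the function with coefficients `v`. They
also swap the two indices in the inner product. -/
theorem IsSingularSequence.isotropicFamily (h : IsSingularSequence hH.embedding e) {s : Finset ℕ}
    (hs : ∀ k ∈ s, e k ≠ 0) :
    IsotropicFamily μ fun x (k : s) => star (e k x) / singularValue hH.embedding k := by
  intro i j
  have hσi := h.pos i (hs i i.2)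
  have hσj := h.pos j (hs j j.2)
  obtain ⟨h1, h2⟩ := hH.inner_embedding (e j) (e i)
  have heq : ∀ x, star (star (e i x) / (singularValue hH.embedding i : ℂ)) *
      (star (e j x) / (singularValue hH.embedding j : ℂ)) =
      ((singularValue hH.embedding i : ℂ) * singularValue hH.embedding j)⁻¹ *
        (star (e j x) * e i x) := fun x => by
    rw [star_div₀, star_star, Complex.star_def, Complex.conj_ofReal,
      div_mul_div_comm, div_eq_inv_mul, mul_comm (e i x)]
  simp only [heq]
  refine ⟨h1.const_mul _, ?_⟩
  rw [integral_const_mul, h2, h.inner_map]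
  by_cases hij : i = j
  · subst hij
    have : (singularValue hH.embedding i : ℂ) ≠ 0 := by exact_mod_cast hσi.ne'
    rw [if_pos rfl, if_pos rfl]
    push_cast
    field_simp
  · rw [if_neg hij, if_neg fun H => hij (Subtype.ext H.symm), mul_zero]

open Matrix in
theorem star_dotProduct_eq_singularCombination (s : Finset ℕ) (x : D) (v : s → ℂ) :
    star (fun k : s => star (e k x) / (singularValue hH.embedding k : ℂ)) ⬝ᵥ v =
      singularCombination hH.embedding e s v x := by
  change _ = (∑ k : s, (v k / singularValue hH.embedding k) • e k : H) x
  rw [RKHS.coe_finsetSum, Finset.sum_apply, dotProduct]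
  refine Finset.sum_congr rfl fun k _ => ?_
  rw [Pi.star_apply, star_div₀, star_star, Complex.star_def, Complex.conj_ofReal,
    RKHS.coe_smul, Pi.smul_apply, smul_eq_mul]
  ring

/-- The error analysis with free parameters: `β` bounds the middle block, and the two square roots
bound the tail and its image under the method. -/
theorem IsSingularSequence.linSamplingNumber_le (h : IsSingularSequence hH.embedding e)
    (he : e 0 ≠ 0) {m n : ℕ} (hm : 1 ≤ m) {ε φ φ₀ l β r : ℝ} (hε : 0 < ε) (hφ0 : 0 < φ)
    (hφ1 : φ < 1) (hφ₀ : φ₀ < φ) (hl : 0 < l) (hlε : l ≤ n / (1 + ε) - (m - 1) / ε)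
    {q : ℕ → ℝ} (hq : ∀ k, e k ≠ 0 → 0 < q k)
    (hqφ : ∀ s : Finset ℕ, (∀ k ∈ s, m ≤ k ∧ e k ≠ 0) → ∑ k ∈ s, 1 / q k ≤ φ₀)
    (hβ0 : 0 ≤ β)
    (hβ : ∀ k, m ≤ k → e k ≠ 0 → singularValue hH.embedding k ^ 2 *
      (1 + (q k + n / (1 - φ) - 1 / φ) / l) ≤ β ^ 2) (hr : 0 < r) :
    linSamplingNumber μ (unitBallFunctions H) n ≤
      ENNReal.ofReal (β + √r + √(n * r / l)) := by
  classical
  -- The unused potential φ - φ₀ pays for the normalized tail kernel `R / r`.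
  obtain ⟨N, hmN, hN1, hN2⟩ : ∃ N, m ≤ N ∧ ∑' k, singularValue hH.embedding (k + N) ^ 2 ≤ r ∧
      ∑' k, singularValue hH.embedding (k + N) ^ 2 < r * (φ - φ₀) := by
    have h1 := tendsto_sum_nat_add fun k => singularValue hH.embedding k ^ 2
    have h2 := h1.eventually (gt_mem_nhds hr)
    have h3 := h1.eventually (gt_mem_nhds (mul_pos hr (sub_pos.2 hφ₀)))
    obtain ⟨N, ⟨hN1, hN2⟩, hN3⟩ := ((h2.and h3).and (Filter.eventually_ge_atTop m)).exists
    exact ⟨N, hN3, hN1.le, hN2⟩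
  set T := hH.embedding with hT
  set I := (Finset.range m).filter fun k => e k ≠ 0 with hI
  set J := (Finset.Ico m N).filter fun k => e k ≠ 0 with hJ
  have hIe : ∀ k ∈ I, e k ≠ 0 := fun k hk => (Finset.mem_filter.1 hk).2
  have hJe : ∀ k ∈ J, e k ≠ 0 := fun k hk => (Finset.mem_filter.1 hk).2
  have hJm : ∀ k ∈ J, m ≤ k := fun k hk => (Finset.mem_Ico.1 (Finset.mem_filter.1 hk).1).1
  have hJI : Disjoint J I := by
    refine Finset.disjoint_left.2 fun k hk hk' => ?_
    have := Finset.mem_range.1 (Finset.mem_filter.1 hk').1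
    exact absurd (hJm k hk) (not_le.2 this)
  have hIne : Nonempty I := ⟨⟨0, Finset.mem_filter.2 ⟨Finset.mem_range.2 hm, he⟩⟩⟩
  have hIcard : Fintype.card I ≤ m := by
    rw [Fintype.card_coe]
    exact (Finset.card_filter_le _ _).trans (by simp)
  let R : D → ℝ := fun x => ∑' k, ‖e (k + N) x‖ ^ 2
  have hR0 : ∀ x, 0 ≤ R x := fun x => tsum_nonneg fun _ => by positivity
  obtain ⟨hRi, hRint⟩ := h.integral_tsum_norm_sq N
  obtain ⟨x, t, ht, hlow, hup, hRt⟩ := exists_points_weights (h.isotropicFamily hIe)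
    (h.isotropicFamily hJe) hIcard hε hφ0 hφ1 (q := fun k : J => q k) (fun k => hq k (hJe k k.2))
    (R := fun x => R x / r) (fun x => div_nonneg (hR0 x) hr.le) (hRi.div_const r) (by
      have h1 : ∑ k : J, 1 / q k ≤ φ₀ := by
        rw [Finset.sum_coe_sort J fun k => 1 / q k]
        exact hqφ J fun k hk => ⟨hJm k hk, hJe k hk⟩
      have h2 : ∫ x, R x / r ∂μ < φ - φ₀ := by
        rw [integral_div, hRint, div_lt_iff₀ hr]
        linarith
      linarith) n
  simp only [star_dotProduct_eq_singularCombination] at hlow hup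
  let samp : H →ₗ[ℂ] EuclideanSpace ℂ (Fin n) :=
    { toFun := fun f => WithLp.toLp 2 fun i => (√(t i) : ℂ) * f (x i)
      map_add' := fun f g => by ext i; simp [mul_add]
      map_smul' := fun c f => by ext i; simp [mul_left_comm] }
  have hsamp : ∀ f, ‖samp f‖ ^ 2 = ∑ i, t i * ‖f (x i)‖ ^ 2 := fun f => by
    rw [EuclideanSpace.norm_sq_eq]
    refine Finset.sum_congr rfl fun i _ => ?_
    change ‖(√(t i) : ℂ) * f (x i)‖ ^ 2 = _
    rw [norm_mul, mul_pow, Complex.norm_real, Real.norm_of_nonneg (Real.sqrt_nonneg _),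
      Real.sq_sqrt (ht i).le]
  let G : EuclideanSpace ℂ I →ₗ[ℂ] H :=
    singularCombination T e I ∘ₗ (WithLp.linearEquiv 2 ℂ (I → ℂ)).toLinearMap
  have hG : ∀ v, ‖T (G v)‖ ^ 2 = ‖v‖ ^ 2 := fun v => by
    rw [EuclideanSpace.norm_sq_eq]
    exact h.norm_sq_map_singularCombination hIe _
  obtain ⟨L, hL1, hL2⟩ := exists_leftInverse_of_bounded_below (samp ∘ₗ G) hl fun v => by
    rw [LinearMap.comp_apply, hsamp, EuclideanSpace.norm_sq_eq]
    exact (mul_le_mul_of_nonneg_right hlε (Finset.sum_nonneg fun _ _ => by positivity)).trans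
      (hlow v)
  let A : H →ₗ[ℂ] H := G ∘ₗ L ∘ₗ samp
  have hAfix : ∀ v, A (G v) = G v := fun v => congrArg G (hL1 v)
  have hAnorm : ∀ f, ‖T (A f)‖ ^ 2 ≤ (∑ i, t i * ‖f (x i)‖ ^ 2) / l := fun f => by
    rw [le_div_iff₀' hl, ← hsamp]
    change l * ‖T (G (L (samp f)))‖ ^ 2 ≤ _
    rw [hG]
    exact hL2 _
  have hAsum : ∀ f, A f =
      ∑ i, f (x i) • ((√(t i) : ℂ) • G (L (EuclideanSpace.single i 1))) := fun f => by
    have h1 : samp f = ∑ i, (f (x i) * (√(t i) : ℂ)) • EuclideanSpace.single i (1 : ℂ) := by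
      ext j
      simp [samp, mul_comm, Pi.single_apply]
    change G (L (samp f)) = _
    rw [h1]
    simp only [map_sum, map_smul, smul_smul]
  refine hH.linSamplingNumber_le x
    (fun i => (√(t i) : ℂ) • G (L (EuclideanSpace.single i 1))) fun f hf => ?_
  rw [← hAsum]
  set f₁ := ∑ k ∈ Finset.Ico m N, ⟪e k, f⟫_ℂ • e k with hf₁
  set f₂ := f - ∑ k ∈ Finset.range N, ⟪e k, f⟫_ℂ • e k with hf₂
  have hsplit : f - A f = (f₁ - A f₁) + f₂ - A f₂ := by
    have h1 : ∑ k ∈ Finset.range N, ⟪e k, f⟫_ℂ • e k =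
        ∑ k ∈ Finset.range m, ⟪e k, f⟫_ℂ • e k + f₁ :=
      (Finset.sum_range_add_sum_Ico _ hmN).symm
    have h2 : f = ∑ k ∈ Finset.range m, ⟪e k, f⟫_ℂ • e k + f₁ + f₂ := by
      rw [← h1, hf₂]; abel
    have h3 : A (∑ k ∈ Finset.range m, ⟪e k, f⟫_ℂ • e k) =
        ∑ k ∈ Finset.range m, ⟪e k, f⟫_ℂ • e k := by
      rw [← h.singularCombination_coeff]
      exact hAfix (WithLp.toLp 2 fun k : I => singularValue T k * ⟪e k, f⟫_ℂ)
    have h4 : A f = ∑ k ∈ Finset.range m, ⟪e k, f⟫_ℂ • e k + A f₁ + A f₂ := by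
      conv_lhs => rw [h2]
      rw [map_add, map_add, h3]
    rw [h4]
    nth_rewrite 1 [h2]
    abel
  have hf2 : ‖f‖ ^ 2 ≤ 1 := by
    have := norm_nonneg f
    nlinarith
  have hf₂x : ∀ y, ‖f₂ y‖ ^ 2 ≤ R y := fun y =>
    (h.norm_apply_sub_sum_sq_le f N y).trans (mul_le_of_le_one_left (hR0 y) hf2)
  have hmain : ‖T (f₁ - A f₁)‖ ≤ β := by
    -- Pythagoras: `f₁` and `A f₁` lie over disjoint blocks of singular vectors.
    rw [← sq_le_sq₀ (norm_nonneg _) hβ0, map_sub, norm_sub_sq (𝕜 := ℂ)]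
    have hcomb : f₁ = singularCombination T e J fun k => singularValue T k * ⟪e k, f⟫_ℂ :=
      (h.singularCombination_coeff _ _).symm
    have hinner : ⟪T f₁, T (A f₁)⟫_ℂ = 0 := by
      nth_rewrite 1 [hcomb]
      exact h.inner_map_singularCombination hJI _ _
    have h1 : ‖T f₁‖ ^ 2 = ∑ k : J, ‖(singularValue T k : ℂ) * ⟪e k, f⟫_ℂ‖ ^ 2 := by
      rw [hcomb]
      exact h.norm_sq_map_singularCombination hJe _
    have h2 : ‖T (A f₁)‖ ^ 2 ≤ (∑ k : J, (q k + n / (1 - φ) - 1 / φ) *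
        ‖(singularValue T k : ℂ) * ⟪e k, f⟫_ℂ‖ ^ 2) / l := by
      refine (hAnorm f₁).trans (div_le_div_of_nonneg_right ?_ hl.le)
      rw [hcomb]
      exact hup fun k => singularValue T k * ⟪e k, f⟫_ℂ
    rw [hinner, h1, map_zero, mul_zero, sub_zero]
    refine (add_le_add_right h2 _).trans ?_
    rw [Finset.sum_div, ← Finset.sum_add_distrib]
    calc _ ≤ ∑ k : J, β ^ 2 * ‖⟪e k, f⟫_ℂ‖ ^ 2 := by
          refine Finset.sum_le_sum fun k _ => ?_
          have h3 := hβ k (hJm k k.2) (hJe k k.2)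
          rw [norm_mul, mul_pow, Complex.norm_real, Real.norm_eq_abs, sq_abs]
          calc _ = singularValue T k ^ 2 * (1 + (q k + n / (1 - φ) - 1 / φ) / l) *
                ‖⟪e k, f⟫_ℂ‖ ^ 2 := by ring
            _ ≤ _ := by gcongr
      _ = β ^ 2 * ∑ k ∈ J, ‖⟪e k, f⟫_ℂ‖ ^ 2 := by
          rw [← Finset.mul_sum, Finset.sum_coe_sort J fun k => ‖⟪e k, f⟫_ℂ‖ ^ 2]
      _ ≤ β ^ 2 * 1 := by
          gcongr
          exact (h.sum_norm_inner_sq_le f J).trans hf2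
      _ = β ^ 2 := mul_one _
  have htail : ‖T f₂‖ ≤ √r := by
    refine Real.le_sqrt_of_sq_le ?_
    rw [← (hH.norm_sq_embedding f₂).2]
    exact (integral_mono (hH.norm_sq_embedding f₂).1 hRi hf₂x).trans (hRint.le.trans hN1)
  have htailA : ‖T (A f₂)‖ ≤ √(n * r / l) := by
    refine Real.le_sqrt_of_sq_le ((hAnorm f₂).trans ?_)
    gcongr
    calc ∑ i, t i * ‖f₂ (x i)‖ ^ 2 ≤ ∑ i, t i * R (x i) :=
          Finset.sum_le_sum fun i _ => mul_le_mul_of_nonneg_left (hf₂x _) (ht i).le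
      _ = (∑ i, t i * (R (x i) / r)) * r := by
          rw [Finset.sum_mul]
          exact Finset.sum_congr rfl fun i _ => by field_simp
      _ ≤ n * r := by gcongr
  rw [hsplit, map_sub, map_add]
  calc _ ≤ ‖T (f₁ - A f₁)‖ + ‖T f₂‖ + ‖T (A f₂)‖ :=
        (norm_sub_le _ _).trans (add_le_add_left (norm_add_le _ _) _)
    _ ≤ _ := by gcongr

end Sampling

/-! ### Optimization of the barrier parameters. -/

section Parameters

/-- Here `p` is the share 1/q_m of the upper potential, `a` is the factor in 1/q_k = a σ_k² for k >
m, and `y` stands for σ_k². The equation says that the shares exhaust the potential `φ`. -/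
theorem exists_barrier_weights {n φ ν : ℝ} (hn : 1 ≤ n) (hφ0 : 0 < φ) (hφ1 : φ < 1)
    (hν : 0 < ν) : ∃ a p : ℝ, 0 < a ∧ 0 < p ∧ p + a * (n * (φ * ν) ^ 2) = φ ∧
      (∀ y, 0 ≤ y → y ≤ ((1 - φ) * ν) ^ 2 →
        y * (1 / p + n / (1 - φ) - 1 / φ) ≤ (n + 1) * ν ^ 2) ∧
      (∀ y, 0 ≤ y → y ≤ ((1 - φ) * ν) ^ 2 →
        1 / a + y * (n / (1 - φ) - 1 / φ) ≤ (n + 1) * ν ^ 2) := by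
  have h1 : 0 < 1 - φ := by linarith
  have hn0 : 0 < n := by linarith
  -- This decides the sign of n/(1 - φ) - 1/φ. If it is nonnegative, the largest `y` is the worst,
  -- and `W` makes both bounds equal to nν² there.
  rcases le_or_gt (1 - φ) (n * φ) with hc | hc
  · set W := n * φ ^ 2 + (1 - φ) ^ 2 with hW
    have hW0 : 0 < W := by positivity
    have hbr : 0 ≤ n / (1 - φ) - 1 / φ := by
      rw [sub_nonneg, div_le_div_iff₀ hφ0 h1]; linarith
    refine ⟨φ / (W * ν ^ 2), φ * (1 - φ) ^ 2 / W, by positivity, by positivity, ?_, ?_, ?_⟩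
    · field_simp
      rw [hW]; ring
    · intro y hy0 hy
      have hp : 1 / φ ≤ 1 / (φ * (1 - φ) ^ 2 / W) := by
        apply one_div_le_one_div_of_le (by positivity)
        rw [div_le_iff₀ hW0]
        have : (1 - φ) ^ 2 ≤ W := by rw [hW]; nlinarith [sq_nonneg φ]
        gcongr
      have h3 : 0 ≤ n / (1 - φ) := by positivity
      calc _ ≤ ((1 - φ) * ν) ^ 2 * (1 / (φ * (1 - φ) ^ 2 / W) + n / (1 - φ) - 1 / φ) :=
            mul_le_mul_of_nonneg_right hy (by linarith)
        _ = n * ν ^ 2 := by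
            rw [hW]; field_simp; ring
        _ ≤ _ := by nlinarith [sq_nonneg ν]
    · intro y hy0 hy
      calc _ ≤ 1 / (φ / (W * ν ^ 2)) + ((1 - φ) * ν) ^ 2 * (n / (1 - φ) - 1 / φ) := by gcongr
        _ = n * ν ^ 2 := by
            rw [hW]; field_simp; ring
        _ ≤ _ := by nlinarith [sq_nonneg ν]
  · have hbr : n / (1 - φ) - 1 / φ ≤ 0 := by
      rw [sub_nonpos, div_le_div_iff₀ h1 hφ0]; linarith
    have hd : 0 < n + 1 - n * φ := by nlinarith
    -- Now the bracket can be dropped in the second bound, which dictates `a`; `p` is what remains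
    -- of `φ`.
    refine ⟨1 / ((n + 1) * ν ^ 2), φ * (n + 1 - n * φ) / (n + 1), by positivity, by positivity,
      ?_, ?_, ?_⟩
    · field_simp
      ring
    · intro y hy0 hy
      have hp : 1 / (φ * (n + 1 - n * φ) / (n + 1)) - 1 / φ = n / (n + 1 - n * φ) := by
        have := hd.ne'
        rw [one_div_div, div_sub_div _ _ (by positivity) hφ0.ne', div_eq_div_iff (by positivity) this]
        ring
      have h4 : (1 - φ) * (n / (n + 1 - n * φ)) ≤ 1 := by
        rw [← mul_div_assoc, div_le_one hd]; linarith
      calc y * (1 / (φ * (n + 1 - n * φ) / (n + 1)) + n / (1 - φ) - 1 / φ)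
          = y * (n / (n + 1 - n * φ) + n / (1 - φ)) := by rw [← hp]; ring
        _ ≤ ((1 - φ) * ν) ^ 2 * (n / (n + 1 - n * φ) + n / (1 - φ)) :=
            mul_le_mul_of_nonneg_right hy (by positivity)
        _ = ν ^ 2 * ((1 - φ) * ((1 - φ) * (n / (n + 1 - n * φ)) + n)) := by
            field_simp
        _ ≤ ν ^ 2 * (1 * (1 + n)) := by gcongr; linarith
        _ = (n + 1) * ν ^ 2 := by ring
    · intro y hy0 hy
      rw [one_div_one_div]
      nlinarith [mul_nonpos_of_nonneg_of_nonpos hy0 hbr]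

/-- With m - 1 = n r², the maximum of n/(1 + ε) - (m - 1)/ε is n(1 - r)², attained at ε = r/(1 - r).
-/
theorem exists_lower_parameter {m n : ℕ} (hm : 1 ≤ m) (hmn : m ≤ n) :
    0 < 1 - √(((m : ℝ) - 1) / n) ∧ ∃ ε l : ℝ, 0 < ε ∧ 0 < l ∧ l ≤ n / (1 + ε) - (m - 1) / ε ∧
      n + 1 ≤ l * ((1 + 1 / (1 - √(((m : ℝ) - 1) / n))) ^ 2 - 1) := by
  have hm' : (1 : ℝ) ≤ m := by exact_mod_cast hm
  have hmn' : (m : ℝ) ≤ n := by exact_mod_cast hmn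
  have hn0 : (0 : ℝ) < n := by linarith
  set r := √(((m : ℝ) - 1) / n) with hr
  have hr0 : 0 ≤ r := Real.sqrt_nonneg _
  have hr2 : n * r ^ 2 = m - 1 := by
    rw [hr, Real.sq_sqrt (div_nonneg (by linarith) hn0.le)]
    field_simp
  have hr1 : r < 1 := by
    by_contra! h
    have : (n : ℝ) * 1 ≤ n * r ^ 2 := by gcongr; exact one_le_pow₀ h
    linarith
  refine ⟨by linarith, ?_⟩
  rcases hm.eq_or_lt with rfl | hm2
  · have hr00 : r = 0 := by rw [hr]; simp
    -- For m = 1 the optimum ε = 0 is excluded, but `l = 2n/3` suffices: 3l = 2n ≥ n + 1.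
    refine ⟨1 / 2, 2 * n / 3, by norm_num, by positivity, ?_, ?_⟩
    · refine le_of_eq ?_
      push_cast
      ring
    · rw [hr00]
      norm_num
      linarith
  · have hrpos : 0 < r := by
      refine hr0.lt_of_ne fun h => ?_
      rw [← h] at hr2
      have : (1 : ℝ) < m := by exact_mod_cast hm2
      linarith
    have hρ : 0 < 1 - r := by linarith
    refine ⟨r / (1 - r), n * (1 - r) ^ 2, by positivity, by positivity, le_of_eq ?_, ?_⟩
    · rw [← hr2]
      have : 1 + r / (1 - r) = 1 / (1 - r) := by field_simp; ring
      rw [this]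
      field_simp
    · have : n * (1 - r) ^ 2 * ((1 + 1 / (1 - r)) ^ 2 - 1) = 2 * (n * (1 - r)) + n := by
        field_simp; ring
      rw [this]
      -- From n(1 - r²) = n - m + 1 ≥ 1 and 1 + r ≤ 2 it follows that 2n(1 - r) ≥ 1.
      nlinarith

end Parameters

/-! ### The sampling bound and its two special cases. -/

section Main

open Filter Topology

variable {D : Type*} [MeasurableSpace D] {μ : Measure D} {H : Type*}
  [NormedAddCommGroup H] [InnerProductSpace ℂ H] [CompleteSpace H] [RKHS ℂ H D ℂ]

/-- The slack `η` keeps all parameters positive, even if σ_m or the tail sum vanishes, and leaves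
potential for the part beyond N. -/
theorem IsSingularSequence.linSamplingNumber_le_of_pos {hH : EmbedsInL2 H μ} {e : ℕ → H}
    (h : IsSingularSequence hH.embedding e) (he : e 0 ≠ 0) {m n : ℕ} (hm : 1 ≤ m) (hmn : m ≤ n)
    {ε l : ℝ} (hε : 0 < ε) (hl : 0 < l) (hlε : l ≤ n / (1 + ε) - (m - 1) / ε) {C : ℝ}
    (hC0 : 0 ≤ C) (hC : n + 1 ≤ l * (C ^ 2 - 1)) {η : ℝ} (hη : 0 < η) :
    linSamplingNumber μ (unitBallFunctions H) n ≤
      ENNReal.ofReal (C * (singularValue hH.embedding m + η +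
        (√(1 / n * ∑' k : Set.Ioi m, singularValue hH.embedding k ^ 2) + η)) +
          √η + √(n * η / l)) := by
  set σ := singularValue hH.embedding with hσ
  set S := ∑' k : Set.Ioi m, σ k ^ 2 with hS
  have hn : (1 : ℝ) ≤ n := by exact_mod_cast hm.trans hmn
  have hσ0 : ∀ k, 0 ≤ σ k := fun k => by
    by_cases hk : e k = 0
    · exact (h.eq_zero k hk).ge
    · exact (h.pos k hk).le
  have hS0 : 0 ≤ S := tsum_nonneg fun _ => by positivity
  set τ := √(1 / n * S) with hτ
  have hτ0 : 0 ≤ τ := Real.sqrt_nonneg _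
  have hτ2 : n * τ ^ 2 = S := by
    rw [hτ, Real.sq_sqrt (by positivity)]; field_simp
  set ν := σ m + η + (τ + η) with hν
  have hσm := hσ0 m
  have hν0 : 0 < ν := by positivity
  -- This splits `ν` so that φν dominates the tail term and (1 - φ)ν dominates σ_m.
  set φ := (τ + η) / ν with hφ
  have hφ0 : 0 < φ := by positivity
  have hφν : φ * ν = τ + η := div_mul_cancel₀ _ hν0.ne'
  have hφν' : (1 - φ) * ν = σ m + η := by rw [sub_mul, hφν, hν]; ring
  have hφ1 : φ < 1 := by
    rw [hφ, div_lt_one hν0, hν]; linarith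
  obtain ⟨a, p, ha, hp, hap, hbm, hbk⟩ := exists_barrier_weights hn hφ0 hφ1 hν0
  rw [hφν] at hap
  rw [hφν'] at hbm hbk
  have hσle : ∀ k, m ≤ k → σ k ^ 2 ≤ (σ m + η) ^ 2 := fun k hk => by
    have := h.antitone hk
    have := hσ0 k
    gcongr
    linarith
  refine h.linSamplingNumber_le he hm hε hφ0 hφ1 (φ₀ := p + a * S) ?_ hl hlε
    -- Index m needs its own weight because `S` starts at m + 1.
    (q := fun k => 1 / (if k = m then p else a * σ k ^ 2)) ?_ ?_ (by positivity) ?_ hη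
  · rw [← hap, ← hτ2]
    gcongr
    linarith
  · intro k hk
    have := h.pos k hk
    split_ifs <;> positivity
  · intro s hs
    simp only [one_div_one_div]
    have hsum : ∑ k ∈ s, (Set.Ioi m).indicator (fun k => σ k ^ 2) k ≤ S := by
      rw [hS, tsum_subtype (Set.Ioi m) fun k => σ k ^ 2]
      exact (h.summable.indicator _).sum_le_tsum s fun k _ =>
        Set.indicator_nonneg (fun _ _ => by positivity) _
    have hpm : ∑ k ∈ s, (if k = m then p else 0) ≤ p := by
      rw [Finset.sum_ite_eq']
      split_ifs <;> linarith
    calc _ ≤ ∑ k ∈ s, ((if k = m then p else 0) +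
          a * (Set.Ioi m).indicator (fun k => σ k ^ 2) k) := by
          refine Finset.sum_le_sum fun k hk => ?_
          by_cases hkm : k = m
          · simp [hkm]
          · have : k ∈ Set.Ioi m := lt_of_le_of_ne (hs k hk).1 (Ne.symm hkm)
            simp [hkm, Set.indicator_of_mem this]
      _ ≤ _ := by
          rw [Finset.sum_add_distrib, ← Finset.mul_sum]
          gcongr
  · intro k hk hek
    have hσk := h.pos k hek
    have hkey : σ k ^ 2 * (1 / (if k = m then p else a * σ k ^ 2) + n / (1 - φ) - 1 / φ) ≤
        (n + 1) * ν ^ 2 := by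
      by_cases hkm : k = m
      · rw [if_pos hkm]
        exact hbm _ (by positivity) (hσle k hk)
      · rw [if_neg hkm]
        refine le_trans (le_of_eq ?_) (hbk _ (by positivity) (hσle k hk))
        have : σ k ≠ 0 := hσk.ne'
        field_simp
        ring
    have hσν : σ k ^ 2 ≤ ν ^ 2 := (hσle k hk).trans (by
      gcongr
      rw [hν]; linarith)
    calc _ = σ k ^ 2 + σ k ^ 2 *
          (1 / (if k = m then p else a * σ k ^ 2) + n / (1 - φ) - 1 / φ) / l := by ring
      _ ≤ ν ^ 2 + (n + 1) * ν ^ 2 / l := by gcongr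
      _ ≤ ν ^ 2 + (l * (C ^ 2 - 1)) * ν ^ 2 / l := by gcongr
      _ = (C * ν) ^ 2 := by field_simp; ring

theorem EmbedsInL2.exists_isSingularSequence (hH : EmbedsInL2 H μ) (hK : kernelTrace H μ < ∞) :
    ∃ e, IsSingularSequence hH.embedding e :=
  exists_singular_sequence _ (fun _ hf => hH.embedding_ne_zero hf) fun b =>
    hH.summable_norm_sq hK b

theorem EmbedsInL2.linSamplingNumber_le_tail [Nonempty D] (hH : EmbedsInL2 H μ) (hK : kernelTrace H μ < ∞)
    {m n : ℕ} (hm : 1 ≤ m) (hmn : m ≤ n) :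
    linSamplingNumber μ (unitBallFunctions H) n ≤
      ENNReal.ofReal ((1 + 1 / (1 - √(((m : ℝ) - 1) / n))) *
        (singularValue hH.embedding m +
          √(1 / n * ∑' k : Set.Ioi m, singularValue hH.embedding k ^ 2))) := by
  obtain ⟨e, h⟩ := hH.exists_isSingularSequence hK
  obtain ⟨hρ, ε, l, hε, hl, hlε, hC⟩ := exists_lower_parameter hm hmn
  have hC0 : 0 ≤ 1 + 1 / (1 - √(((m : ℝ) - 1) / n)) := by positivity
  by_cases he : e 0 = 0
  -- Here `H` is the zero space, and any sampling points do.
  · have hσ : ∀ k, singularValue hH.embedding k ≤ 0 := fun k =>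
      (h.antitone (Nat.zero_le k)).trans (h.eq_zero 0 he).le
    have hek : ∀ k, e k = 0 := fun k => by
      by_contra hk
      exact absurd (h.pos k hk) (not_lt.2 (hσ k))
    have hf : ∀ f : H, f = 0 := fun f => (h.hasSum f).unique (by simp [hek, hasSum_zero])
    refine hH.linSamplingNumber_le (fun _ => Classical.arbitrary D) 0 fun f _ => ?_
    rw [hf (f - _), map_zero, norm_zero, h.eq_zero m (hek m), zero_add]
    positivity
  · have hlim : Tendsto (fun η : ℝ => ENNReal.ofReal ((1 + 1 / (1 - √(((m : ℝ) - 1) / n))) *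
        (singularValue hH.embedding m + η +
        (√(1 / n * ∑' k : Set.Ioi m, singularValue hH.embedding k ^ 2) + η)) +
          √η + √(n * η / l))) (𝓝[>] 0)
        (𝓝 (ENNReal.ofReal ((1 + 1 / (1 - √(((m : ℝ) - 1) / n))) *
        (singularValue hH.embedding m +
          √(1 / n * ∑' k : Set.Ioi m, singularValue hH.embedding k ^ 2))))) := by
      refine tendsto_nhdsWithin_of_tendsto_nhds (Continuous.tendsto' ?_ _ _ (by simp))
      exact ENNReal.continuous_ofReal.comp (by fun_prop)
    refine ge_of_tendsto hlim ?_
    filter_upwards [self_mem_nhdsWithin] with η hη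
    exact h.linSamplingNumber_le_of_pos he hm hmn hε hl hlε hC0 hC hη

end Main

theorem corollary3p3 {D : Type*} [MeasurableSpace D] [Nonempty D] (μ : Measure D)
    {H : Type*} [NormedAddCommGroup H] [InnerProductSpace ℂ H] [CompleteSpace H] [RKHS ℂ H D ℂ]
    (hH : EmbedsInL2 H μ) (hK : kernelTrace H μ < ∞) :
    Summable (fun k : ℕ => singularValue hH.embedding k ^ 2) ∧
    ∀ m : ℕ, 1 ≤ m →
      (∀ n : ℕ, m ≤ n →
        linSamplingNumber μ (unitBallFunctions H) n ≤
          ENNReal.ofReal ((1 + 1 / (1 - √(((m : ℝ) - 1) / n))) *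
            (singularValue hH.embedding m +
              √(1 / n * ∑' k : Set.Ioi m, singularValue hH.embedding k ^ 2)))) ∧
      linSamplingNumber μ (unitBallFunctions H) (2 * m) ≤
        ENNReal.ofReal (5 *
          (singularValue hH.embedding m +
            √(1 / (2 * m) * ∑' k : Set.Ioi m, singularValue hH.embedding k ^ 2))) ∧
      linSamplingNumber μ (unitBallFunctions H) m ≤
        ENNReal.ofReal ((2 * m + 1) *
          (singularValue hH.embedding m +
            √(1 / m * ∑' k : Set.Ioi m, singularValue hH.embedding k ^ 2))) := by
  obtain ⟨e, h⟩ := hH.exists_isSingularSequence hK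
  have hσ : ∀ k, 0 ≤ singularValue hH.embedding k := fun k => by
    by_cases hk : e k = 0
    · exact (h.eq_zero k hk).ge
    · exact (h.pos k hk).le
  refine ⟨h.summable, fun m hm => ⟨fun n hn => hH.linSamplingNumber_le_tail hK hm hn, ?_, ?_⟩⟩
  · have h1 := hH.linSamplingNumber_le_tail hK hm (n := 2 * m) (by omega)
    push_cast at h1
    refine h1.trans (ENNReal.ofReal_le_ofReal ?_)
    have hm0 : (0 : ℝ) < m := by exact_mod_cast hm
    have hr : √(((m : ℝ) - 1) / (2 * m)) ≤ 3 / 4 := by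
      refine Real.sqrt_le_iff.2 ⟨by norm_num, ?_⟩
      rw [div_le_iff₀ (by positivity)]
      linarith
    refine mul_le_mul_of_nonneg_right ?_ (add_nonneg (hσ m) (Real.sqrt_nonneg _))
    have : 1 / (1 - √(((m : ℝ) - 1) / (2 * m))) ≤ 1 / (1 / 4) :=
      one_div_le_one_div_of_le (by norm_num) (by linarith)
    linarith
  · refine (hH.linSamplingNumber_le_tail hK hm le_rfl).trans (ENNReal.ofReal_le_ofReal ?_)
    have hm0 : (1 : ℝ) ≤ m := by exact_mod_cast hm
    -- Completing the square; then 1/(1 - r) ≤ 2m.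
    have hr : √(((m : ℝ) - 1) / m) ≤ 1 - 1 / (2 * m) := by
      refine Real.sqrt_le_iff.2 ⟨?_, ?_⟩
      · rw [sub_nonneg, div_le_one (by positivity)]
        linarith
      · have : (1 - 1 / (2 * (m : ℝ))) ^ 2 = (m - 1) / m + (1 / (2 * m)) ^ 2 := by
          field_simp
          ring
        rw [this]
        exact le_add_of_nonneg_right (sq_nonneg _)
    refine mul_le_mul_of_nonneg_right ?_ (add_nonneg (hσ m) (Real.sqrt_nonneg _))
    have : 1 / (1 - √(((m : ℝ) - 1) / m)) ≤ 1 / (1 / (2 * (m : ℝ))) :=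
      one_div_le_one_div_of_le (by positivity) (by linarith)
    rw [one_div_one_div] at this
    linarith
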